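/- Let $d\ge 1$, let $(\mathbb M,\mathcal F_{\mathbb M},\mathbb Q)$ be a probability space, $\gamma>0$, and let $\eta$ be a Poisson process on $\mathbb R^d\times\mathbb M$ with intensity measure $\gamma\,\lambda_d\otimes\mathbb Q$, where $\lambda_d$ is Lebesgue measure. Let $(g_m)_{m\in\mathbb M}$ be integrable measurable functions $g_m:\mathbb R^d\to[0,\infty)$ whose closed supports $K_m=\overline{\{g_m>0\}}$ are compact and convex with $\lambda_d(K_m)>0$, such that $g_m$ is continuous and concave on $K_m$ and $m\mapsto g_m$ is measurable with respect to the Borel $\sigma$-algebra of the $L^1$-norm. Let $V_0,\dots,V_d$ denote the intrinsic volumes, i.e. the coefficients in Steiner's formula $\lambda_d(K+rB^d)=\sum_{k=0}^d r^{d-k}\kappa_{d-k}V_k(K)$, $r\ge0$, where $B^d$ is the closed unit ball of $\mathbb R^d$ and $\kappa_j$ the volume of the $j$-dimensional unit ball, and assume that $$\int_{\mathbb M}V_i(K_m)\,\mathbb Q(dm)<\infty,\qquad i\in\{1,\dots,d\}.$$ For $u>0$ put $Z_u=\{y\in\mathbb R^d:\sum_{(x,m)\in\eta}g_m(y-x)\ge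 u\}$. Let $W\subset\mathbb R^d$ be compact and convex with $\lambda_d(W)>0$, and $W_r=rW$ for $r\ge1$. Let $\mathcal R^d$ be the set of finite unions of compact convex subsets of $\mathbb R^d$, and let $\varphi:\mathcal R^d\to\mathbb R$ be a geometric functional, i.e. $\varphi$ is measurable with respect to the $\sigma$-algebra generated by the sets $\{A:A\cap U\ne\emptyset\}$, $U$ open; translation invariant; additive, meaning $\varphi(\emptyset)=0$ and $\varphi(A\cup B)=\varphi(A)+\varphi(B)-\varphi(A\cap B)$; and bounded on the compact convex subsets of $[0,1]^d$. With $C^d=[0,1]^d$, $C_0^d=[0,1)^d$ and $\partial^+C^d=C^d\setminus C_0^d$, write $\varphi(A\cap C_0^d)=\varphi(A\cap C^d)-\varphi(A\cap\partial^+C^d)$. Then $Z_u\cap W_r$ (for every $r\ge1$), $Z_u\cap C^d$ and $Z_u\cap\partial^+C^d$ almost surely belong to $\mathcal R^d$, the random variables $\varphi(Z_u\cap W_r)$ and $\varphi(Z_u\cap C_0^d)$ are integrable, and $$\lim_{r\to\infty}\frac{\mathbb E[\varphi(Z_u\cap W_r)]}{\lambda_d(W_r)}=\mathbb E[\varphi(Z_u\cap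 C_0^d)].$$ -/

import Mathlib

open MeasureTheory ProbabilityTheory Filter Topology Set
open scoped NNReal ENNReal Pointwise

namespace ShotNoise

/-- `ℝ^d` with the Euclidean norm. -/
abbrev E (d : ℕ) : Type := EuclideanSpace ℝ (Fin d)

/-! ### Convex geometry -/

/-- Membership in the convex ring: finite unions of compact convex sets (the empty set included). -/
def IsPolyconvex {d : ℕ} (A : Set (E d)) : Prop :=
  ∃ (n : ℕ) (K : Fin n → Set (E d)),
    (∀ i, IsCompact (K i) ∧ Convex ℝ (K i)) ∧ A = ⋃ i, K i

/-- The convex ring of `ℝ^d`. -/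
abbrev ConvexRing (d : ℕ) : Type := {A : Set (E d) // IsPolyconvex A}

/-- The trace on the convex ring of the Borel `σ`-algebra of the Fell topology on closed sets,
i.e. the `σ`-algebra generated by the sets `{A : A ∩ U ≠ ∅}` with `U` open. -/
abbrev fellMeasurableSpace (d : ℕ) : MeasurableSpace (ConvexRing d) :=
  MeasurableSpace.generateFrom
    {S | ∃ U : Set (E d), IsOpen U ∧ S = {A : ConvexRing d | (A.1 ∩ U).Nonempty}}

/-- The closed unit cube `[0,1]^d`. -/
def unitCube (d : ℕ) : Set (E d) := {x | ∀ i, x i ∈ Set.Icc (0 : ℝ) 1}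

/-- The half-open unit cube `[0,1)^d`. -/
def halfOpenCube (d : ℕ) : Set (E d) := {x | ∀ i, x i ∈ Set.Ico (0 : ℝ) 1}

/-- The upper right boundary `∂⁺[0,1]^d = [0,1]^d \ [0,1)^d`. -/
def upperBoundary (d : ℕ) : Set (E d) := unitCube d \ halfOpenCube d

/-- Geometric functionals: measurable, translation invariant, additive, locally bounded
functionals on the convex ring. The values of `φ` on sets that are not polyconvex are irrelevant. -/
structure IsGeometricFunctional {d : ℕ} (φ : Set (E d) → ℝ) : Prop where
  measurable : @Measurable (ConvexRing d) ℝ (fellMeasurableSpace d) _ fun A => φ A.1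
  translation_invariant : ∀ A : Set (E d), IsPolyconvex A →
    ∀ x : E d, φ ((fun y => y + x) '' A) = φ A
  empty : φ ∅ = 0
  additive : ∀ A B : Set (E d), IsPolyconvex A → IsPolyconvex B →
    φ (A ∪ B) = φ A + φ B - φ (A ∩ B)
  locally_bounded : ∃ C : ℝ, ∀ A : Set (E d), IsCompact A → Convex ℝ A →
    A ⊆ unitCube d → |φ A| ≤ C

/-- `φ(A ∩ [0,1)^d) := φ(A ∩ [0,1]^d) - φ(A ∩ ∂⁺[0,1]^d)`. -/
def evalHalfOpenCube {d : ℕ} (φ : Set (E d) → ℝ) (A : Set (E d)) : ℝ :=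
  φ (A ∩ unitCube d) - φ (A ∩ upperBoundary d)

/-- `κ_j`, the volume of the `j`-dimensional unit ball. -/
noncomputable def kappa (j : ℕ) : ℝ := volume.real (Metric.closedBall (0 : E j) 1)

/-- `v 0, …, v d` are the coefficients of the Steiner polynomial of `K`:
`λ_d(K + r B^d) = ∑_{k=0}^d r^{d-k} κ_{d-k} v_k` for all `r ≥ 0`. -/
def IsSteinerCoeff {d : ℕ} (K : Set (E d)) (v : Fin (d + 1) → ℝ) : Prop :=
  ∀ r : ℝ, 0 ≤ r →
    volume.real (K + Metric.closedBall (0 : E d) r) =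
      ∑ k : Fin (d + 1), r ^ (d - (k : ℕ)) * kappa (d - (k : ℕ)) * v k

open Classical in
/-- The intrinsic volume `V_k(K)` of a compact convex set `K`: the (unique) `k`-th coefficient in
the Steiner formula. (By Steiner's theorem such coefficients exist for every compact convex
`K`.) -/
noncomputable def intrinsicVolume {d : ℕ} (k : Fin (d + 1)) (K : Set (E d)) : ℝ :=
  if h : ∃ v : Fin (d + 1) → ℝ, IsSteinerCoeff K v then h.choose k else 0

/-! ### Poisson processes -/

/-- Counting measures: countable sums of Dirac measures. -/
def IsCountingMeasure {X : Type*} [MeasurableSpace X] (μ : Measure X) : Prop :=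
  ∃ (ι : Type) (_ : Countable ι) (x : ι → X), μ = Measure.sum fun i => Measure.dirac (x i)

/-- `η` is a Poisson process on `X` with intensity measure `Λ`, on the probability space
`(Ω, P)`: a random counting measure such that `η(B)` is Poisson distributed with parameter `Λ(B)`
(`η(B) = ∞` a.s. if `Λ(B) = ∞`), with independent values on disjoint sets. -/
structure IsPoissonProcess {Ω X : Type*} [MeasurableSpace Ω] [MeasurableSpace X]
    (P : Measure Ω) (Λ : Measure X) (η : Ω → Measure X) : Prop where
  measurable : Measurable η
  counting : ∀ᵐ ω ∂P, IsCountingMeasure (η ω)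
  poisson : ∀ B : Set X, MeasurableSet B → Λ B ≠ ∞ →
    P.map (fun ω => η ω B) =
      (poissonMeasure (Λ B).toNNReal).map (fun n : ℕ => (n : ℝ≥0∞))
  infinite : ∀ B : Set X, MeasurableSet B → Λ B = ∞ → ∀ᵐ ω ∂P, η ω B = ∞
  independent : ∀ (n : ℕ) (B : Fin n → Set X), (∀ i, MeasurableSet (B i)) →
    Pairwise (fun i j => Disjoint (B i) (B j)) → iIndepFun (fun i ω => η ω (B i)) P

/-! ### The shot noise model -/

/-- Admissible families of kernel functions `g_m : ℝ^d → [0,∞)`, `m ∈ M`, with closed supports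
`K_m = tsupport (g m)`. The family is measurable as a map into the space of integrable functions
with the Borel `σ`-algebra of the `L¹`-norm. -/
structure IsKernelFamily {d : ℕ} {M : Type*} [MeasurableSpace M] (g : M → E d → ℝ) : Prop where
  measurable : ∀ m, Measurable (g m)
  nonneg : ∀ m x, 0 ≤ g m x
  integrable : ∀ m, Integrable (g m) (volume : Measure (E d))
  compact_support : ∀ m, IsCompact (tsupport (g m))
  convex_support : ∀ m, Convex ℝ (tsupport (g m))
  volume_support_pos : ∀ m, 0 < volume (tsupport (g m))
  continuousOn : ∀ m, ContinuousOn (g m) (tsupport (g m))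
  concaveOn : ∀ m, ConcaveOn ℝ (tsupport (g m)) (g m)
  measurable_L1 : @Measurable M (E d →₁[volume] ℝ) _ (borel (E d →₁[volume] ℝ))
    fun m => (integrable m).toL1 (g m)

/-- The shot noise field `f_μ(y) = ∑_{(x,m) ∈ μ} g_m(y - x)`, as the integral with respect to the
counting measure `μ`. -/
noncomputable def shotNoise {d : ℕ} {M : Type*} [MeasurableSpace M] (g : M → E d → ℝ)
    (μ : Measure (E d × M)) (y : E d) : ℝ≥0∞ :=
  ∫⁻ p, ENNReal.ofReal (g p.2 (y - p.1)) ∂μ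

/-- The excursion set `Z_u = {y : f_μ(y) ≥ u}`. -/
def excursionSet {d : ℕ} {M : Type*} [MeasurableSpace M] (g : M → E d → ℝ) (u : ℝ)
    (μ : Measure (E d × M)) : Set (E d) :=
  {y | ENNReal.ofReal u ≤ shotNoise g μ y}

end ShotNoise

/-! Cut space into half-open lattice cubes. Additivity and translation invariance turn `φ(Z_u ∩
W_r)` into a sum over lattice points of half-open-cube values of shifted processes
(`IsGeometricFunctional.eq_sum_evalHalfOpenCube`, `IsKernelFamily.eq_sum_shift`). The shifted
processes have the same law, so every cube inside `W_r` contributes the same mean, namely the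
claimed limit. The means of boundary cubes are bounded by one constant, and there are only `o(r^d)`
of them (`exists_card_cubes_bounds`).

Integrability rests on a deterministic estimate. A level set of a sum of `n` concave bumps splits by
inclusion-exclusion into superlevel sets of concave functions, so a geometric functional of it
inside the unit cube is at most `3^n` times its bound on convex sets
(`IsGeometricFunctional.abs_levelSet_le`). Here `n` counts the kernels hitting a ball around the
cube; it is Poisson, and `3^n` is integrable once its mean is finite. That mean is the integrated
volume of `K_m + R B^d` up to constants, finite by the moment assumption and Steiner's formula,
which is proved here through the area formula for the homotheties along the normals of `K`.

Measurability has two layers. On the convex ring, `φ` is a measurable function of countably many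
hitting indicators. For the excursion set, hitting a compact set is expressed through suprema of
kernels over small balls, and these are measurable in the mark because they can be detected by
integrals that are continuous in the `L¹` norm. -/

namespace ShotNoise

/-! ### Steiner's formula -/

/-- `p` is the metric projection onto `K`, in its variational characterisation. -/
structure IsMetricProjection {d : ℕ} (K : Set (E d)) (p : E d → E d) : Prop where
  mem : ∀ x, p x ∈ K
  inner_le : ∀ x, ∀ w ∈ K, inner ℝ (x - p x) (w - p x) ≤ 0

theorem exists_isMetricProjection {d : ℕ} {K : Set (E d)} (hne : K.Nonempty) (hK : IsCompact K)
    (hconv : Convex ℝ K) : ∃ p, IsMetricProjection K p := by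
  choose p hp hp' using exists_norm_eq_iInf_of_complete_convex hne hK.isComplete hconv
  exact ⟨p, hp, fun x => (norm_eq_iInf_iff_real_inner_le_zero hconv (hp x)).1 (hp' x)⟩

namespace IsMetricProjection

variable {d : ℕ} {K : Set (E d)} {p : E d → E d}

/-- Firm nonexpansiveness: add the variational inequality at `x` tested with `p y` and the one at
`y` tested with `p x`. -/
theorem norm_sub_sq_le (h : IsMetricProjection K p) (x y : E d) :
    ‖p x - p y‖ ^ 2 ≤ inner ℝ (p x - p y) (x - y) := by
  have h1 := h.inner_le x (p y) (h.mem y)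
  have h2 := h.inner_le y (p x) (h.mem x)
  rw [← real_inner_self_eq_norm_sq]
  have e : inner ℝ (p x - p y) (x - y) - inner ℝ (p x - p y) (p x - p y)
      = - inner ℝ (x - p x) (p y - p x) - inner ℝ (y - p y) (p x - p y) := by
    simp only [inner_sub_left, inner_sub_right, real_inner_comm]
    ring
  linarith

theorem lipschitzWith (h : IsMetricProjection K p) : LipschitzWith 1 p := by
  refine LipschitzWith.of_dist_le_mul fun x y => ?_
  rw [dist_eq_norm, dist_eq_norm, NNReal.coe_one, one_mul]
  have h1 := h.norm_sub_sq_le x y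
  have h2 := real_inner_le_norm (p x - p y) (x - y)
  by_contra! hlt
  nlinarith [norm_nonneg (p x - p y), norm_nonneg (x - y)]

theorem eq_of_inner_le (h : IsMetricProjection K p) {x v : E d} (hv : v ∈ K)
    (hv' : ∀ w ∈ K, inner ℝ (x - v) (w - v) ≤ 0) : p x = v := by
  have h1 := h.inner_le x v hv
  have h2 := hv' (p x) (h.mem x)
  have e : inner ℝ (x - p x) (v - p x) + inner ℝ (x - v) (p x - v)
      = inner ℝ (v - p x) (v - p x) := by
    simp only [inner_sub_left, inner_sub_right, real_inner_comm]
    ring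
  have h3 : inner ℝ (v - p x) (v - p x) ≤ 0 := by linarith
  have := inner_self_eq_zero.1 (le_antisymm h3 real_inner_self_nonneg)
  exact (sub_eq_zero.1 this).symm

theorem mem_add_closedBall_iff (h : IsMetricProjection K p) {x : E d} {r : ℝ} :
    x ∈ K + Metric.closedBall (0 : E d) r ↔ ‖x - p x‖ ≤ r := by
  constructor
  · rintro ⟨k, hk, b, hb, rfl⟩
    rw [mem_closedBall_zero_iff] at hb
    refine le_trans ?_ hb
    set x := k + b
    have h1 := h.inner_le x k hk
    have e : ‖b‖ ^ 2 = ‖x - p x‖ ^ 2 - 2 * inner ℝ (x - p x) (k - p x) + ‖k - p x‖ ^ 2 := by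
      rw [← norm_sub_sq_real]
      congr 2
      simp [x]
    exact (sq_le_sq₀ (norm_nonneg _) (norm_nonneg _)).1 (by nlinarith [sq_nonneg ‖k - p x‖])
  · intro hx
    exact ⟨p x, h.mem x, x - p x, by simpa using hx, by simp⟩

/-- The homothety with ratio `s` along the normal rays of `K`. -/
def stretch (p : E d → E d) (s : ℝ) (x : E d) : E d := p x + s • (x - p x)

/-- The vector `x - p x` lies in the normal cone of `K` at `p x`, and a cone is stable under
nonnegative scaling. -/
theorem proj_stretch (h : IsMetricProjection K p) {s : ℝ} (hs : 0 ≤ s) (x : E d) :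
    p (stretch p s x) = p x := by
  refine h.eq_of_inner_le (h.mem x) fun w hw => ?_
  rw [stretch, add_sub_cancel_left, inner_smul_left]
  exact mul_nonpos_of_nonneg_of_nonpos hs (h.inner_le x w hw)

theorem stretch_stretch (h : IsMetricProjection K p) {s t : ℝ} (hs : 0 ≤ s) (x : E d) :
    stretch p t (stretch p s x) = stretch p (t * s) x := by
  conv_lhs => rw [stretch, h.proj_stretch hs]
  simp [stretch, smul_smul]

theorem injective_stretch (h : IsMetricProjection K p) {s : ℝ} (hs : 0 < s) :
    Function.Injective (stretch p s) := by
  intro x y hxy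
  have := congrArg (stretch p s⁻¹) hxy
  rw [h.stretch_stretch hs.le, h.stretch_stretch hs.le, inv_mul_cancel₀ hs.ne'] at this
  simpa [stretch] using this

theorem image_stretch (h : IsMetricProjection K p) {s : ℝ} (hs : 0 < s) :
    stretch p s '' (K + Metric.closedBall (0 : E d) 1) = K + Metric.closedBall (0 : E d) s := by
  ext y
  constructor
  · rintro ⟨x, hx, rfl⟩
    rw [h.mem_add_closedBall_iff] at hx ⊢
    rw [h.proj_stretch hs.le, stretch, add_sub_cancel_left, norm_smul, Real.norm_of_nonneg hs.le]
    nlinarith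
  · intro hy
    refine ⟨stretch p s⁻¹ y, ?_, ?_⟩
    · rw [h.mem_add_closedBall_iff] at hy ⊢
      rw [h.proj_stretch (inv_nonneg.2 hs.le), stretch, add_sub_cancel_left, norm_smul,
        Real.norm_of_nonneg (inv_nonneg.2 hs.le), inv_mul_le_iff₀ hs]
      simpa using hy
    · rw [h.stretch_stretch (inv_nonneg.2 hs.le)]
      simp [hs.ne', stretch]

/-- `stretch p s` is `p + s (id - p)`, and firm nonexpansiveness makes both `p` and `id - p`
monotone. This fixes the sign of the Jacobian, so that no absolute value spoils its polynomial
dependence on `s`. -/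
theorem inner_stretch_sub_nonneg (h : IsMetricProjection K p) {s : ℝ} (hs : 0 ≤ s) (x y : E d) :
    0 ≤ inner ℝ (stretch p s x - stretch p s y) (x - y) := by
  have h1 := h.norm_sub_sq_le x y
  have h2 := real_inner_le_norm (p x - p y) (x - y)
  have h3 : ‖p x - p y‖ ≤ ‖x - y‖ := by
    simpa [dist_eq_norm] using h.lipschitzWith.dist_le_mul x y
  have e : inner ℝ (stretch p s x - stretch p s y) (x - y)
      = inner ℝ (p x - p y) (x - y) + s * (‖x - y‖ ^ 2 - inner ℝ (p x - p y) (x - y)) := by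
    rw [← real_inner_self_eq_norm_sq]
    simp only [stretch, inner_sub_left, inner_sub_right, inner_add_left, inner_smul_left]
    simp
    ring
  rw [e]
  have : inner ℝ (p x - p y) (x - y) ≤ ‖x - y‖ ^ 2 := by
    nlinarith [norm_nonneg (x - y)]
  nlinarith [sq_nonneg ‖p x - p y‖, mul_nonneg hs (sub_nonneg.2 this)]

theorem lipschitzWith_stretch (h : IsMetricProjection K p) {s : ℝ} (hs : 0 ≤ s) :
    LipschitzWith (1 + 2 * s.toNNReal) (stretch p s) := by
  refine LipschitzWith.of_dist_le_mul fun x y => ?_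
  have h3 : ‖p x - p y‖ ≤ ‖x - y‖ := by
    simpa [dist_eq_norm] using h.lipschitzWith.dist_le_mul x y
  have e : stretch p s x - stretch p s y = (p x - p y) + s • ((x - y) - (p x - p y)) := by
    simp only [stretch, smul_sub]; abel
  rw [dist_eq_norm, dist_eq_norm, e]
  calc _ ≤ ‖p x - p y‖ + s * (‖x - y‖ + ‖p x - p y‖) := by
        refine (norm_add_le _ _).trans ?_
        rw [norm_smul, Real.norm_of_nonneg hs]
        gcongr
        exact norm_sub_le _ _
    _ ≤ _ := by
        push_cast
        rw [Real.coe_toNNReal _ hs]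
        nlinarith

end IsMetricProjection

/-- Lipschitz maps preserve null sets of the `d`-dimensional Hausdorff measure, which is a Haar
measure and so has the same null sets as Lebesgue measure. -/
theorem volume_image_eq_zero_of_lipschitzWith {d : ℕ} {f : E d → E d} {C : ℝ≥0}
    (hf : LipschitzWith C f) {s : Set (E d)} (hs : volume s = 0) : volume (f '' s) = 0 := by
  have hH : (μH[(d : ℝ)] : Measure (E d)).IsAddHaarMeasure := by
    simpa using isAddHaarMeasure_hausdorffMeasure (E := E d)
  have h1 : (μH[(d : ℝ)] : Measure (E d)) s = 0 :=
    (Measure.absolutelyContinuous_isAddHaarMeasure (μH[(d : ℝ)] : Measure (E d)) volume) hs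
  refine (Measure.absolutelyContinuous_isAddHaarMeasure volume (μH[(d : ℝ)] : Measure (E d))) ?_
  refine le_antisymm ((hf.hausdorffMeasure_image_le (by positivity) s).trans ?_) zero_le
  simp [h1]

theorem exists_polynomial_det_add_smul {d : ℕ} (A B : E d →L[ℝ] E d) :
    ∃ q : Polynomial ℝ, q.degree < (d + 1 : ℕ) ∧ ∀ s : ℝ, q.eval s = (A + s • B).det := by
  let b := (EuclideanSpace.basisFun (Fin d) ℝ).toBasis
  let MA := LinearMap.toMatrix b b (A : E d →ₗ[ℝ] E d)
  let MB := LinearMap.toMatrix b b (B : E d →ₗ[ℝ] E d)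
  refine ⟨((Polynomial.X : Polynomial ℝ) • MB.map Polynomial.C + MA.map Polynomial.C).det, ?_,
    fun s => ?_⟩
  · refine lt_of_le_of_lt Polynomial.degree_le_natDegree ?_
    have := Polynomial.natDegree_det_X_add_C_le MB MA
    rw [Fintype.card_fin] at this
    exact_mod_cast Nat.lt_succ_of_le this
  · rw [ContinuousLinearMap.det, ← LinearMap.det_toMatrix b, ← Polynomial.coe_evalRingHom,
      RingHom.map_det]
    congr 1
    ext i j
    simp [MA, MB]
    ring

/-- On the segment from the identity to `A` every map except possibly `A` is strictly monotone,
hence nonsingular. The determinant starts at `1` and cannot become negative without vanishing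
earlier. -/
theorem det_nonneg_of_inner_nonneg {d : ℕ} (A : E d →L[ℝ] E d)
    (hA : ∀ v, 0 ≤ inner ℝ (A v) v) : 0 ≤ A.det := by
  let F : ℝ → ℝ := fun t => (t • A + (1 - t) • ContinuousLinearMap.id ℝ (E d)).det
  have hF : Continuous F := ContinuousLinearMap.continuous_det.comp (by fun_prop)
  have h0 : F 0 = 1 := by simp [F, ContinuousLinearMap.det]
  have h1 : F 1 = A.det := by
    have : (1 : ℝ) • A + (1 - 1 : ℝ) • ContinuousLinearMap.id ℝ (E d) = A := by
      ext v; simp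
    simp only [F, this]
  have hne : ∀ t ∈ Ico (0 : ℝ) 1, F t ≠ 0 := by
    intro t ht hdet
    have hlt := (LinearMap.bot_lt_ker_of_det_eq_zero hdet)
    obtain ⟨v, hv, hv0⟩ := Submodule.exists_mem_ne_zero_of_ne_bot hlt.ne'
    have hv' : t • A v + (1 - t) • v = 0 := by simpa using hv
    have := congrArg (fun w => inner ℝ w v) hv'
    simp only [inner_add_left, inner_smul_left, inner_zero_left] at this
    have hpos : 0 < inner ℝ v v := real_inner_self_pos.2 hv0
    simp only [conj_trivial] at this
    nlinarith [mul_nonneg ht.1 (hA v), mul_pos (sub_pos.2 ht.2) hpos]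
  by_contra! hneg
  rw [← h1] at hneg
  obtain ⟨t, ht, hFt⟩ := intermediate_value_Icc' zero_le_one hF.continuousOn
    (show (0 : ℝ) ∈ Icc (F 1) (F 0) from ⟨hneg.le, by rw [h0]; exact zero_le_one⟩)
  rcases eq_or_lt_of_le ht.2 with rfl | h
  · exact hneg.ne hFt
  · exact hne t ⟨ht.1, h⟩ hFt

theorem IsMetricProjection.det_nonneg {d : ℕ} {K : Set (E d)} {p : E d → E d}
    (h : IsMetricProjection K p) {s : ℝ} (hs : 0 ≤ s) {x : E d} {A : E d →L[ℝ] E d}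
    (hA : HasFDerivAt (stretch p s) A x) : 0 ≤ A.det := by
  refine det_nonneg_of_inner_nonneg A fun v => ?_
  have hl := hA.hasLineDerivAt v
  have hd : HasDerivAt (fun t : ℝ => stretch p s (x + t • v)) (A v) 0 := hl
  have ht := hd.tendsto_slope_zero_right
  have ht' := (innerSL ℝ v).continuous.continuousAt.tendsto.comp ht
  rw [real_inner_comm]
  refine ge_of_tendsto ht' ?_
  filter_upwards [self_mem_nhdsWithin] with t ht
  have ht : 0 < t := ht
  have := h.inner_stretch_sub_nonneg hs (x + t • v) x
  simp only [add_sub_cancel_left, inner_smul_right] at this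
  have h2 : 0 ≤ inner ℝ (stretch p s (x + t • v) - stretch p s x) v := by
    exact nonneg_of_mul_nonneg_right this ht
  change 0 ≤ inner ℝ v (t⁻¹ • (stretch p s (x + (0 + t) • v) - stretch p s (x + (0 : ℝ) • v)))
  rw [zero_add, zero_smul, add_zero, inner_smul_right, real_inner_comm]
  exact mul_nonneg (inv_nonneg.2 ht.le) h2

/-- Area formula for `stretch p s`, which maps the unit parallel body bijectively onto the one of
radius `s`. By Rademacher's theorem the points where `p` is not differentiable form a null set, and
so does their image. -/
theorem IsMetricProjection.volume_add_closedBall {d : ℕ} {K : Set (E d)} {p : E d → E d}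
    (h : IsMetricProjection K p) (hK : IsCompact K) {s : ℝ} (hs : 0 < s) :
    volume (K + Metric.closedBall (0 : E d) s) =
      ∫⁻ x in (K + Metric.closedBall (0 : E d) 1) ∩ {x | DifferentiableAt ℝ p x},
        ENNReal.ofReal (fderiv ℝ p x +
          s • (ContinuousLinearMap.id ℝ (E d) - fderiv ℝ p x)).det := by
  set N : Set (E d) := K + Metric.closedBall (0 : E d) 1 with hN
  set D : Set (E d) := N ∩ {x | DifferentiableAt ℝ p x} with hD
  have hNm : MeasurableSet N := (hK.add (isCompact_closedBall 0 1)).measurableSet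
  have hDm : MeasurableSet D := hNm.inter (measurableSet_of_differentiableAt ℝ p)
  have hder : ∀ x ∈ D, HasFDerivAt (stretch p s)
      (fderiv ℝ p x + s • (ContinuousLinearMap.id ℝ (E d) - fderiv ℝ p x)) x := fun x hx =>
    hx.2.hasFDerivAt.add (((hasFDerivAt_id x).sub hx.2.hasFDerivAt).const_smul s)
  have hnull : volume (stretch p s '' (N \ D)) = 0 := by
    refine volume_image_eq_zero_of_lipschitzWith (h.lipschitzWith_stretch hs.le) ?_
    refine measure_mono_null ?_ (h.lipschitzWith.ae_differentiableAt (μ := volume))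
    rintro x ⟨hx, hxD⟩ hx'
    exact hxD ⟨hx, hx'⟩
  have himg : volume (K + Metric.closedBall (0 : E d) s) = volume (stretch p s '' D) := by
    rw [← h.image_stretch hs, ← hN]
    refine le_antisymm ?_ (measure_mono (image_mono inter_subset_left))
    conv_lhs => rw [← sdiff_union_of_subset (show D ⊆ N from inter_subset_left), image_union]
    refine (measure_union_le _ _).trans ?_
    rw [hnull, zero_add]
  rw [himg, ← lintegral_abs_det_fderiv_eq_addHaar_image volume hDm
    (fun x hx => (hder x hx).hasFDerivWithinAt) (h.injective_stretch hs).injOn]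
  refine setLIntegral_congr_fun hDm fun x hx => ?_
  rw [abs_of_nonneg (h.det_nonneg hs.le (hder x hx))]

theorem exists_polynomial_volume_add_closedBall {d : ℕ} {K : Set (E d)} (hne : K.Nonempty)
    (hK : IsCompact K) (hconv : Convex ℝ K) :
    ∃ q : Polynomial ℝ, q.degree < (d + 1 : ℕ) ∧
      ∀ s : ℝ, 0 ≤ s → volume.real (K + Metric.closedBall (0 : E d) s) = q.eval s := by
  obtain ⟨p, hp⟩ := exists_isMetricProjection hne hK hconv
  set D : Set (E d) := (K + Metric.closedBall (0 : E d) 1) ∩ {x | DifferentiableAt ℝ p x} with hD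
  have hDm : MeasurableSet D := (hK.add (isCompact_closedBall 0 1)).measurableSet.inter
    (measurableSet_of_differentiableAt ℝ p)
  let J : ℝ → E d → ℝ := fun s x =>
    (fderiv ℝ p x + s • (ContinuousLinearMap.id ℝ (E d) - fderiv ℝ p x)).det
  have hJm : ∀ s, Measurable (J s) := fun s =>
    ContinuousLinearMap.continuous_det.measurable.comp
      ((measurable_fderiv ℝ p).add ((measurable_const.sub (measurable_fderiv ℝ p)).const_smul s))
  have hJ0 : ∀ s, 0 < s → ∀ x ∈ D, 0 ≤ J s x := fun s hs x hx => by
    refine hp.det_nonneg (s := s) hs.le (x := x) ?_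
    exact hx.2.hasFDerivAt.add (((hasFDerivAt_id x).sub hx.2.hasFDerivAt).const_smul s)
  have hfin : ∀ s, volume (K + Metric.closedBall (0 : E d) s) < ∞ := fun s =>
    (hK.add (isCompact_closedBall 0 s)).measure_lt_top
  have hint : ∀ s, 0 < s → IntegrableOn (J s) D := fun s hs => by
    refine ⟨(hJm s).aestronglyMeasurable, ?_⟩
    rw [hasFiniteIntegral_iff_ofReal ((ae_restrict_iff' hDm).2 (ae_of_all _ (hJ0 s hs))),
      ← hp.volume_add_closedBall hK hs]
    exact hfin s
  have hvol : ∀ s, 0 < s → volume.real (K + Metric.closedBall (0 : E d) s) = ∫ x in D, J s x :=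
    fun s hs => by
    rw [integral_eq_lintegral_of_nonneg_ae ((ae_restrict_iff' hDm).2 (ae_of_all _ (hJ0 s hs)))
      (hJm s).aestronglyMeasurable, ← hp.volume_add_closedBall hK hs, Measure.real]
  -- Interpolation avoids proving integrability of each coefficient of the Jacobian: `J s` is a
  -- fixed combination of the values at `d + 1` positive nodes, which are already known to be
  -- integrable. Positivity matters since the area formula needs `s > 0`.
  let nodes : Fin (d + 1) → ℝ := fun i => (i : ℝ) + 1
  have hinj : Set.InjOn nodes (Finset.univ : Finset (Fin (d + 1))) := by
    intro i _ j _ hij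
    simpa [nodes, Fin.ext_iff] using hij
  have hpos : ∀ i, 0 < nodes i := fun i => by positivity
  let q := Lagrange.interpolate Finset.univ nodes fun i => ∫ x in D, J (nodes i) x
  have hq : ∀ s, 0 < s → volume.real (K + Metric.closedBall (0 : E d) s) = q.eval s := by
    intro s hs
    rw [hvol s hs]
    have hJs : ∀ x, J s x =
        ∑ i, J (nodes i) x * (Lagrange.basis Finset.univ nodes i).eval s := by
      intro x
      obtain ⟨r, hr, hr'⟩ := exists_polynomial_det_add_smul (fderiv ℝ p x)
        (ContinuousLinearMap.id ℝ (E d) - fderiv ℝ p x)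
      have := Lagrange.eq_interpolate hinj (f := r) (by simpa using hr)
      have h2 := congrArg (Polynomial.eval s) this
      rw [hr', Lagrange.interpolate_apply, Polynomial.eval_finsetSum] at h2
      simp only [hr', Polynomial.eval_mul, Polynomial.eval_C] at h2
      exact h2
    simp_rw [hJs]
    rw [integral_finsetSum _ fun i _ => (hint _ (hpos i)).mul_const _]
    simp only [integral_mul_const]
    simp [q, Lagrange.interpolate_apply, Polynomial.eval_finsetSum]
  have hdeg : q.degree < (Finset.univ : Finset (Fin (d + 1))).card :=
    Lagrange.degree_interpolate_lt _ hinj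
  rw [Finset.card_fin] at hdeg
  refine ⟨q, hdeg, fun s hs => ?_⟩
  rcases hs.eq_or_lt with rfl | hs
  -- The value at `s = 0` follows by letting `s ↓ 0` on both sides.
  · have h1 : Tendsto (fun s => volume (Metric.cthickening s K)) (𝓝[>] 0) (𝓝 (volume K)) :=
      (tendsto_measure_cthickening_of_isCompact hK).mono_left nhdsWithin_le_nhds
    have h2 := (ENNReal.tendsto_toReal hK.measure_lt_top.ne).comp h1
    have h3 : Tendsto (fun s => q.eval s) (𝓝[>] 0) (𝓝 (q.eval 0)) :=
      q.continuous.continuousAt.tendsto.mono_left nhdsWithin_le_nhds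
    have h4 := tendsto_nhds_unique (h2.congr' ?_) h3
    · simpa [Measure.real] using h4
    · filter_upwards [self_mem_nhdsWithin] with t ht
      rw [← hq t ht, hK.add_closedBall_zero (le_of_lt ht)]
      rfl
  · exact hq s hs

theorem kappa_pos (j : ℕ) : 0 < kappa j :=
  ENNReal.toReal_pos (Metric.measure_closedBall_pos _ _ one_pos).ne'
    (isCompact_closedBall _ _).measure_lt_top.ne

/-- **Steiner's formula**. -/
theorem exists_isSteinerCoeff {d : ℕ} {K : Set (E d)} (hne : K.Nonempty)
    (hK : IsCompact K) (hconv : Convex ℝ K) : ∃ v, IsSteinerCoeff K v := by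
  obtain ⟨q, hq, hq'⟩ := exists_polynomial_volume_add_closedBall hne hK hconv
  refine ⟨fun k => q.coeff (d - k) / kappa (d - k), fun r hr => ?_⟩
  rw [hq' r hr, Polynomial.eval_eq_sum_range' (n := d + 1), ← Finset.sum_range_reflect,
    Finset.sum_range]
  · refine Finset.sum_congr rfl fun k _ => ?_
    have := (kappa_pos (d - k)).ne'
    field_simp
    simp [mul_comm]
  · by_cases h0 : q = 0
    · simp [h0]
    · exact (Polynomial.natDegree_lt_iff_degree_lt h0).2 (by exact_mod_cast hq)

/-- The coefficient of the top power of `r` in Steiner's formula is `V₀(K) = 1`. -/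
theorem IsSteinerCoeff.zero_eq_one {d : ℕ} {K : Set (E d)} (hne : K.Nonempty)
    (hK : IsCompact K) {v : Fin (d + 1) → ℝ} (hv : IsSteinerCoeff K v) : v 0 = 1 := by
  obtain ⟨x, hx⟩ := hne
  obtain ⟨R, hR0, hR⟩ : ∃ R : ℝ, 0 < R ∧ K ⊆ Metric.closedBall 0 R := by
    obtain ⟨R, hR⟩ := hK.isBounded.subset_closedBall 0
    exact ⟨max R 1, by positivity, hR.trans (Metric.closedBall_subset_closedBall (le_max_left _ _))⟩
  have hball : ∀ (y : E d) (r : ℝ), 0 ≤ r →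
      volume.real (Metric.closedBall y r) = r ^ d * kappa d := by
    intro y r hr
    rw [Measure.real, Measure.addHaar_closedBall' _ _ hr]
    simp [kappa, Measure.real, hr]
  -- The parallel body lies between balls of radii `r` and `R + r`, so its volume divided by `r ^ d`
  -- tends to `kappa d`; the Steiner polynomial gives the limit `kappa d * v 0`.
  have h1 : Tendsto (fun r : ℝ => volume.real (K + Metric.closedBall (0 : E d) r) / r ^ d) atTop
      (𝓝 (kappa d)) := by
    have hup : Tendsto (fun r : ℝ => (1 + R * r⁻¹) ^ d * kappa d) atTop (𝓝 (kappa d)) := by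
      simpa using (((tendsto_inv_atTop_zero.const_mul R).const_add 1).pow d).mul_const (kappa d)
    refine tendsto_of_tendsto_of_tendsto_of_le_of_le' tendsto_const_nhds hup ?_ ?_
    · filter_upwards [eventually_gt_atTop 0] with r hr
      rw [le_div_iff₀ (by positivity), mul_comm, ← hball x r hr.le]
      refine measureReal_mono ?_ (hK.add (isCompact_closedBall 0 r)).measure_lt_top.ne
      intro y hy
      exact ⟨x, hx, y - x, by simpa [dist_eq_norm] using hy, by simp⟩
    · filter_upwards [eventually_gt_atTop 0] with r hr
      have : (1 + R * r⁻¹) ^ d * kappa d = (R + r) ^ d * kappa d / r ^ d := by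
        rw [show 1 + R * r⁻¹ = (R + r) / r by field_simp; ring, div_pow]
        ring
      rw [this, ← hball 0 (R + r) (by positivity)]
      refine div_le_div_of_nonneg_right (measureReal_mono ?_ measure_closedBall_lt_top.ne)
        (by positivity)
      rintro _ ⟨a, ha, b, hb, rfl⟩
      have ha := hR ha
      simp only [mem_closedBall_zero_iff] at ha hb ⊢
      exact (norm_add_le _ _).trans (add_le_add ha hb)
  have h2 : Tendsto (fun r : ℝ => volume.real (K + Metric.closedBall (0 : E d) r) / r ^ d) atTop
      (𝓝 (kappa d * v 0)) := by
    have h3 : Tendsto (fun r : ℝ => ∑ k : Fin (d + 1),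
        (r⁻¹) ^ (k : ℕ) * kappa (d - (k : ℕ)) * v k) atTop
        (𝓝 (∑ k : Fin (d + 1), (0 : ℝ) ^ (k : ℕ) * kappa (d - (k : ℕ)) * v k)) :=
      tendsto_finsetSum _ fun k _ =>
        ((tendsto_inv_atTop_zero.pow (k : ℕ)).mul_const _).mul_const _
    rw [Fin.sum_univ_succ] at h3
    simp only [Fin.val_zero, pow_zero, one_mul, Nat.sub_zero, Fin.val_succ, ne_eq,
      Nat.add_eq_zero_iff, one_ne_zero, and_false, not_false_eq_true, zero_pow, zero_mul,
      Finset.sum_const_zero, add_zero] at h3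
    refine h3.congr' ?_
    filter_upwards [eventually_gt_atTop 0] with r hr
    rw [hv r hr.le, Finset.sum_div]
    refine Finset.sum_congr rfl fun k _ => ?_
    have hk : d = (d - k) + k := by omega
    rw [show r ^ d = r ^ (d - (k : ℕ)) * r ^ (k : ℕ) by rw [← pow_add, ← hk], inv_pow]
    field_simp
  have := tendsto_nhds_unique h1 h2
  exact (mul_left_cancel₀ (kappa_pos d).ne' (by rw [mul_one]; exact this)).symm

/-- The parallel volumes of a random convex body are integrable if its intrinsic volumes are. -/
theorem integrable_volume_add_closedBall {d : ℕ} {M : Type*} [MeasurableSpace M] {Q : Measure M}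
    [IsFiniteMeasure Q] {K : M → Set (E d)} (hne : ∀ m, (K m).Nonempty)
    (hK : ∀ m, IsCompact (K m)) (hconv : ∀ m, Convex ℝ (K m))
    (hmoment : ∀ i : Fin (d + 1), 1 ≤ (i : ℕ) → Integrable (fun m => intrinsicVolume i (K m)) Q)
    {r : ℝ} (hr : 0 ≤ r) :
    Integrable (fun m => volume.real (K m + Metric.closedBall (0 : E d) r)) Q := by
  have hS : ∀ m, IsSteinerCoeff (K m) fun i => intrinsicVolume i (K m) := by
    intro m
    have h := exists_isSteinerCoeff (hne m) (hK m) (hconv m)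
    simp only [intrinsicVolume, dif_pos h]
    exact h.choose_spec
  simp_rw [fun m => hS m r hr]
  refine integrable_finsetSum _ fun i _ => Integrable.const_mul ?_ _
  -- The moment assumption omits the index `0`, where the integrand is the constant `1`.
  by_cases hi : 1 ≤ (i : ℕ)
  · exact hmoment i hi
  · have : i = 0 := Fin.ext (by rw [Fin.val_zero]; omega)
    subst this
    simp_rw [fun m => (hS m).zero_eq_one (hne m) (hK m)]
    exact integrable_const _

/-! ### The convex ring -/

namespace IsPolyconvex

variable {d : ℕ} {A B : Set (E d)}

theorem of_iUnion {ι : Type*} [Finite ι] {K : ι → Set (E d)}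
    (hK : ∀ i, IsCompact (K i) ∧ Convex ℝ (K i)) : IsPolyconvex (⋃ i, K i) := by
  obtain ⟨n, ⟨e⟩⟩ := Finite.exists_equiv_fin ι
  exact ⟨n, fun j => K (e.symm j), fun j => hK _, (e.symm.surjective.iUnion_comp K).symm⟩

theorem of_convex (hA : IsCompact A) (hA' : Convex ℝ A) : IsPolyconvex A := by
  have := of_iUnion (K := fun _ : Unit => A) fun _ => ⟨hA, hA'⟩
  rwa [iUnion_const] at this

theorem empty : IsPolyconvex (∅ : Set (E d)) := of_convex isCompact_empty convex_empty

theorem union (hA : IsPolyconvex A) (hB : IsPolyconvex B) : IsPolyconvex (A ∪ B) := by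
  obtain ⟨n, K, hK, rfl⟩ := hA
  obtain ⟨m, L, hL, rfl⟩ := hB
  have := of_iUnion (K := Sum.elim K L) (by rintro (i | i); exacts [hK i, hL i])
  rwa [iUnion_sumElim] at this

theorem inter (hA : IsPolyconvex A) (hB : IsPolyconvex B) : IsPolyconvex (A ∩ B) := by
  obtain ⟨n, K, hK, rfl⟩ := hA
  obtain ⟨m, L, hL, rfl⟩ := hB
  have := of_iUnion (K := fun i : Fin n × Fin m => K i.1 ∩ L i.2) fun i =>
    ⟨(hK i.1).1.inter (hL i.2).1, (hK i.1).2.inter (hL i.2).2⟩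
  rwa [show (⋃ i, K i) ∩ ⋃ i, L i = ⋃ i : Fin n × Fin m, K i.1 ∩ L i.2 by
    ext x; simp [mem_iUnion]]

theorem biUnion {ι : Type*} {s : Finset ι} {A : ι → Set (E d)}
    (hA : ∀ i ∈ s, IsPolyconvex (A i)) : IsPolyconvex (⋃ i ∈ s, A i) := by
  classical
  induction s using Finset.induction_on with
  | empty => simpa using empty
  | insert a s _ ih =>
    rw [Finset.set_biUnion_insert]
    exact (hA a (Finset.mem_insert_self a s)).union
      (ih fun i hi => hA i (Finset.mem_insert_of_mem hi))

theorem isCompact (hA : IsPolyconvex A) : IsCompact A := by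
  obtain ⟨n, K, hK, rfl⟩ := hA
  exact isCompact_iUnion fun i => (hK i).1

theorem preimage_add (hA : IsPolyconvex A) (x : E d) :
    IsPolyconvex ((fun y => y + x) ⁻¹' A) := by
  obtain ⟨n, K, hK, rfl⟩ := hA
  rw [preimage_iUnion]
  refine of_iUnion fun i => ⟨?_, (hK i).2.translate_preimage_left x⟩
  exact (Homeomorph.addRight x).isCompact_preimage.2 (hK i).1

end IsPolyconvex

/-! ### Level sets of sums of concave bumps -/

/-- A nonnegative function which vanishes off the closed convex set `K` and is continuous and
concave on `K`. -/
structure IsConcaveBump {d : ℕ} (K : Set (E d)) (k : E d → ℝ) : Prop where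
  isClosed : IsClosed K
  convex : Convex ℝ K
  continuousOn : ContinuousOn k K
  concaveOn : ConcaveOn ℝ K k
  nonneg : ∀ x, 0 ≤ k x
  eq_zero : ∀ x ∉ K, k x = 0

section LevelSet

variable {d : ℕ} {ι : Type*}

/-- Either the level is reached without bump `a`, or the point lies in `K a`, where the bump can be
absorbed into the concave base function `h`. Both pieces involve one bump fewer. -/
theorem levelSet_insert [DecidableEq ι] {K : ι → Set (E d)} {k : ι → E d → ℝ}
    (hk : ∀ i, IsConcaveBump (K i) (k i)) (D : Set (E d)) (h : E d → ℝ) (u : ℝ)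
    {s : Finset ι} {a : ι} (ha : a ∉ s) :
    {y ∈ D | u ≤ h y + ∑ i ∈ insert a s, k i y} =
      {y ∈ D | u ≤ h y + ∑ i ∈ s, k i y} ∪
        {y ∈ D ∩ K a | u ≤ (h y + k a y) + ∑ i ∈ s, k i y} := by
  ext y
  simp only [Finset.sum_insert ha, mem_ofPred_eq, mem_union, mem_inter_iff]
  have h0 := (hk a).nonneg y
  by_cases hy : y ∈ K a
  · constructor
    · rintro ⟨h1, h2⟩
      exact Or.inr ⟨⟨h1, hy⟩, by linarith⟩
    · rintro (⟨h1, h2⟩ | ⟨⟨h1, -⟩, h2⟩) <;> exact ⟨h1, by linarith⟩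
  · rw [(hk a).eq_zero y hy]
    simp [hy]

/-- Since `k a ≥ 0`, the overlap of the two pieces is again of the same form with one bump fewer, so
inclusion-exclusion stays within the class. -/
theorem levelSet_inter {K : ι → Set (E d)} {k : ι → E d → ℝ}
    (hk : ∀ i, IsConcaveBump (K i) (k i)) (D : Set (E d)) (h : E d → ℝ) (u : ℝ)
    (s : Finset ι) (a : ι) :
    {y ∈ D | u ≤ h y + ∑ i ∈ s, k i y} ∩
        {y ∈ D ∩ K a | u ≤ (h y + k a y) + ∑ i ∈ s, k i y} =
      {y ∈ D ∩ K a | u ≤ h y + ∑ i ∈ s, k i y} := by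
  ext y
  simp only [mem_ofPred_eq, mem_inter_iff]
  have h0 := (hk a).nonneg y
  constructor
  · rintro ⟨⟨h1, h2⟩, ⟨⟨-, h3⟩, -⟩⟩
    exact ⟨⟨h1, h3⟩, h2⟩
  · rintro ⟨⟨h1, h2⟩, h3⟩
    exact ⟨⟨h1, h3⟩, ⟨h1, h2⟩, by linarith⟩

/-- The window `D` and the concave base `h` must vary in the induction, because each step absorbs a
bump. With no bumps left, the set is a superlevel set of a continuous concave function, hence
compact and convex. -/
theorem isPolyconvex_levelSet_aux {K : ι → Set (E d)} {k : ι → E d → ℝ}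
    (hk : ∀ i, IsConcaveBump (K i) (k i)) (u : ℝ) (s : Finset ι) :
    ∀ (D : Set (E d)) (h : E d → ℝ), IsCompact D → Convex ℝ D → ContinuousOn h D →
      ConcaveOn ℝ D h → IsPolyconvex {y ∈ D | u ≤ h y + ∑ i ∈ s, k i y} := by
  classical
  induction s using Finset.induction_on with
  | empty =>
    intro D h hD hDc hcont hconc
    simp only [Finset.sum_empty, add_zero]
    refine IsPolyconvex.of_convex ?_ (hconc.convex_ge u)
    exact hD.of_isClosed_subset
      (hcont.preimage_isClosed_of_isClosed hD.isClosed isClosed_Ici) fun y hy => hy.1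
  | insert a s ha ih =>
    intro D h hD hDc hcont hconc
    rw [levelSet_insert hk D h u ha]
    refine (ih D h hD hDc hcont hconc).union
      (ih (D ∩ K a) (fun y => h y + k a y) (hD.inter_right (hk a).isClosed)
        (hDc.inter (hk a).convex) ?_ ?_)
    · exact (hcont.mono inter_subset_left).add ((hk a).continuousOn.mono inter_subset_right)
    · exact (hconc.subset inter_subset_left (hDc.inter (hk a).convex)).add
        ((hk a).concaveOn.subset inter_subset_right (hDc.inter (hk a).convex))

/-- Each inserted bump replaces one value of `φ` by three: two pieces and their overlap. -/
theorem IsGeometricFunctional.abs_levelSet_le_aux {φ : Set (E d) → ℝ}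
    (hφ : IsGeometricFunctional φ) {C : ℝ}
    (hC : ∀ A : Set (E d), IsCompact A → Convex ℝ A → A ⊆ unitCube d → |φ A| ≤ C)
    {K : ι → Set (E d)} {k : ι → E d → ℝ}
    (hk : ∀ i, IsConcaveBump (K i) (k i)) (u : ℝ) (s : Finset ι) :
    ∀ (D : Set (E d)) (h : E d → ℝ), IsCompact D → Convex ℝ D → D ⊆ unitCube d →
      ContinuousOn h D → ConcaveOn ℝ D h →
      |φ {y ∈ D | u ≤ h y + ∑ i ∈ s, k i y}| ≤ 3 ^ s.card * C := by
  classical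
  induction s using Finset.induction_on with
  | empty =>
    intro D h hD hDc hDC hcont hconc
    simp only [Finset.sum_empty, add_zero, Finset.card_empty, pow_zero, one_mul]
    refine hC _ ?_ (hconc.convex_ge u) fun y hy => hDC hy.1
    exact hD.of_isClosed_subset
      (hcont.preimage_isClosed_of_isClosed hD.isClosed isClosed_Ici) fun y hy => hy.1
  | insert a s ha ih =>
    intro D h hD hDc hDC hcont hconc
    have hD' := hD.inter_right (hk a).isClosed
    have hDc' := hDc.inter (hk a).convex
    have hcont' : ContinuousOn (fun y => h y + k a y) (D ∩ K a) :=
      (hcont.mono inter_subset_left).add ((hk a).continuousOn.mono inter_subset_right)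
    have hconc' : ConcaveOn ℝ (D ∩ K a) (fun y => h y + k a y) :=
      (hconc.subset inter_subset_left hDc').add ((hk a).concaveOn.subset inter_subset_right hDc')
    have hDC' : D ∩ K a ⊆ unitCube d := inter_subset_left.trans hDC
    rw [levelSet_insert hk D h u ha, hφ.additive _ _
      (isPolyconvex_levelSet_aux hk u s D h hD hDc hcont hconc)
      (isPolyconvex_levelSet_aux hk u s (D ∩ K a) _ hD' hDc' hcont' hconc'),
      levelSet_inter hk D h u s a, Finset.card_insert_of_notMem ha, pow_succ]
    have h1 := ih D h hD hDc hDC hcont hconc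
    have h2 := ih (D ∩ K a) _ hD' hDc' hDC' hcont' hconc'
    have h3 := ih (D ∩ K a) h hD' hDc' hDC' (hcont.mono inter_subset_left)
      (hconc.subset inter_subset_left hDc')
    rw [abs_le] at h1 h2 h3 ⊢
    constructor <;> linarith [h1.1, h1.2, h2.1, h2.2, h3.1, h3.2]

theorem isPolyconvex_levelSet {K : ι → Set (E d)} {k : ι → E d → ℝ}
    (hk : ∀ i, IsConcaveBump (K i) (k i)) (u : ℝ) (s : Finset ι) {D : Set (E d)}
    (hD : IsCompact D) (hDc : Convex ℝ D) : IsPolyconvex {y ∈ D | u ≤ ∑ i ∈ s, k i y} := by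
  simpa using isPolyconvex_levelSet_aux hk u s D (fun _ => 0) hD hDc continuousOn_const
    (concaveOn_const 0 hDc)

/-- A geometric functional of a level set of the sum of `n` concave bumps in a convex part of the
unit cube is bounded by `3 ^ n` times its bound on convex sets. -/
theorem IsGeometricFunctional.abs_levelSet_le {φ : Set (E d) → ℝ}
    (hφ : IsGeometricFunctional φ) {C : ℝ}
    (hC : ∀ A : Set (E d), IsCompact A → Convex ℝ A → A ⊆ unitCube d → |φ A| ≤ C)
    {K : ι → Set (E d)} {k : ι → E d → ℝ}
    (hk : ∀ i, IsConcaveBump (K i) (k i)) (u : ℝ) (s : Finset ι) {D : Set (E d)}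
    (hD : IsCompact D) (hDc : Convex ℝ D) (hDC : D ⊆ unitCube d) :
    |φ {y ∈ D | u ≤ ∑ i ∈ s, k i y}| ≤ 3 ^ s.card * C := by
  simpa using hφ.abs_levelSet_le_aux hC hk u s D (fun _ => 0) hD hDc hDC continuousOn_const
    (concaveOn_const 0 hDc)

end LevelSet

/-! ### Unit cubes -/

section Cubes

variable {d : ℕ}

theorem isCompact_unitCube (d : ℕ) : IsCompact (unitCube d) := by
  have h : IsCompact (Set.univ.pi fun _ : Fin d => Icc (0 : ℝ) 1) :=
    isCompact_univ_pi fun _ => isCompact_Icc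
  convert (EuclideanSpace.equiv (Fin d) ℝ).toHomeomorph.isCompact_preimage.2 h using 1
  ext x
  simp only [unitCube, mem_preimage, mem_univ_pi, mem_ofPred_eq]
  rfl

theorem convex_unitCube (d : ℕ) : Convex ℝ (unitCube d) := by
  intro x hx y hy a b ha hb hab i
  simpa using (convex_Icc (0 : ℝ) 1) (hx i) (hy i) ha hb hab

/-- The facet `{x ∈ [0,1]^d : x_i = 1}` of the unit cube. -/
def upperFacet (i : Fin d) : Set (E d) := unitCube d ∩ {x | x i = 1}

theorem isCompact_upperFacet (i : Fin d) : IsCompact (upperFacet i) :=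
  (isCompact_unitCube d).inter_right (isClosed_eq (by fun_prop) continuous_const)

theorem convex_upperFacet (i : Fin d) : Convex ℝ (upperFacet i) := by
  refine (convex_unitCube d).inter ?_
  intro x hx y hy a b _ _ hab
  have hx : x i = 1 := hx
  have hy : y i = 1 := hy
  simp [hx, hy, hab]

theorem upperBoundary_eq_biUnion :
    upperBoundary d = ⋃ i ∈ (Finset.univ : Finset (Fin d)), upperFacet i := by
  ext x
  simp only [upperBoundary, halfOpenCube, Set.mem_sdiff, mem_ofPred_eq, not_forall, Finset.mem_univ,
    iUnion_true, mem_iUnion, upperFacet, mem_inter_iff, exists_and_left]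
  refine and_congr_right fun hx => exists_congr fun i => ?_
  have := hx i
  simp only [mem_Ico, mem_Icc, not_and, not_lt] at this ⊢
  exact ⟨fun h => le_antisymm this.2 (h this.1), fun h _ => h.ge⟩

theorem isPolyconvex_inter_upperBoundary {A : Set (E d)}
    (hA : ∀ D, IsCompact D → Convex ℝ D → IsPolyconvex (A ∩ D)) :
    IsPolyconvex (A ∩ upperBoundary d) := by
  rw [upperBoundary_eq_biUnion, inter_iUnion₂]
  exact IsPolyconvex.biUnion fun i _ => hA _ (isCompact_upperFacet i) (convex_upperFacet i)

theorem isPolyconvex_upperBoundary (d : ℕ) : IsPolyconvex (upperBoundary d) := by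
  simpa using isPolyconvex_inter_upperBoundary (A := univ) fun D hD hDc => by
    simpa using IsPolyconvex.of_convex hD hDc

/-- The same threefold recursion, now over facets; `D` varies because the overlap terms live on `D`
intersected with a facet. -/
theorem IsGeometricFunctional.abs_inter_facets_le {φ : Set (E d) → ℝ}
    (hφ : IsGeometricFunctional φ) {A : Set (E d)} {c : ℝ} (hc : 0 ≤ c)
    (hA : ∀ D, IsCompact D → Convex ℝ D → IsPolyconvex (A ∩ D))
    (hAc : ∀ D, IsCompact D → Convex ℝ D → D ⊆ unitCube d → |φ (A ∩ D)| ≤ c)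
    (s : Finset (Fin d)) : ∀ D, IsCompact D → Convex ℝ D → D ⊆ unitCube d →
      |φ ((A ∩ D) ∩ ⋃ i ∈ s, upperFacet i)| ≤ 3 ^ s.card * c := by
  classical
  induction s using Finset.induction_on with
  | empty => intro D _ _ _; simpa [hφ.empty] using hc
  | insert a s ha ih =>
    intro D hD hDc hDC
    have hF : IsPolyconvex (⋃ i ∈ s, upperFacet i) := IsPolyconvex.biUnion fun i _ =>
      IsPolyconvex.of_convex (isCompact_upperFacet i) (convex_upperFacet i)
    have hD' := hD.inter (isCompact_upperFacet a)
    have hDc' := hDc.inter (convex_upperFacet a)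
    have hDC' : D ∩ upperFacet a ⊆ unitCube d := inter_subset_left.trans hDC
    have e1 : (A ∩ D) ∩ ⋃ i ∈ insert a s, upperFacet i =
        (A ∩ (D ∩ upperFacet a)) ∪ ((A ∩ D) ∩ ⋃ i ∈ s, upperFacet i) := by
      rw [Finset.set_biUnion_insert, inter_union_distrib_left, inter_assoc]
    have e2 : (A ∩ (D ∩ upperFacet a)) ∩ ((A ∩ D) ∩ ⋃ i ∈ s, upperFacet i) =
        (A ∩ (D ∩ upperFacet a)) ∩ ⋃ i ∈ s, upperFacet i := by
      ext x; simp only [mem_inter_iff]; tauto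
    rw [e1, hφ.additive _ _ (hA _ hD' hDc') ((hA D hD hDc).inter hF), e2,
      Finset.card_insert_of_notMem ha, pow_succ]
    have h1 := hAc _ hD' hDc' hDC'
    have h2 := ih D hD hDc hDC
    have h3 := ih _ hD' hDc' hDC'
    have h4 : c ≤ 3 ^ s.card * c := le_mul_of_one_le_left hc (one_le_pow₀ (by norm_num))
    rw [abs_le] at h1 h2 h3 ⊢
    constructor <;> linarith [h1.1, h1.2, h2.1, h2.2, h3.1, h3.2]

theorem IsGeometricFunctional.abs_evalHalfOpenCube_le {φ : Set (E d) → ℝ}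
    (hφ : IsGeometricFunctional φ) {A : Set (E d)} {c : ℝ} (hc : 0 ≤ c)
    (hA : ∀ D, IsCompact D → Convex ℝ D → IsPolyconvex (A ∩ D))
    (hAc : ∀ D, IsCompact D → Convex ℝ D → D ⊆ unitCube d → |φ (A ∩ D)| ≤ c)
    {W : Set (E d)} (hW : IsCompact W) (hWc : Convex ℝ W) :
    |evalHalfOpenCube φ (A ∩ W)| ≤ (1 + 3 ^ d) * c := by
  have hD := hW.inter (isCompact_unitCube d)
  have hDc := hWc.inter (convex_unitCube d)
  have h1 := hAc _ hD hDc inter_subset_right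
  have h2 := hφ.abs_inter_facets_le hc hA hAc Finset.univ _ hD hDc inter_subset_right
  rw [← upperBoundary_eq_biUnion, Finset.card_fin] at h2
  have e : A ∩ (W ∩ unitCube d) ∩ upperBoundary d = A ∩ W ∩ upperBoundary d := by
    have : upperBoundary d ⊆ unitCube d := sdiff_subset
    ext x; simp only [mem_inter_iff]
    have := @this x
    tauto
  rw [e] at h2
  rw [evalHalfOpenCube, inter_assoc]
  rw [abs_le] at h1 h2 ⊢
  constructor <;> linarith [h1.1, h1.2, h2.1, h2.2]

/-- The lattice point `z` as a vector. -/
noncomputable def latticeVec (z : Fin d → ℤ) : E d := WithLp.toLp 2 fun i => (z i : ℝ)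

@[simp]
theorem latticeVec_apply (z : Fin d → ℤ) (i : Fin d) : latticeVec z i = z i := rfl

theorem IsGeometricFunctional.evalHalfOpenCube_preimage {φ : Set (E d) → ℝ}
    (hφ : IsGeometricFunctional φ) {A : Set (E d)} (hA : IsPolyconvex A) (x : E d) :
    evalHalfOpenCube φ ((fun y => y + x) ⁻¹' A) =
      φ (A ∩ (fun y => y + x) '' unitCube d) - φ (A ∩ (fun y => y + x) '' upperBoundary d) := by
  have hU := isPolyconvex_upperBoundary d
  have h1 := hφ.translation_invariant _ ((hA.preimage_add x).inter
    (IsPolyconvex.of_convex (isCompact_unitCube d) (convex_unitCube d))) x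
  have h2 := hφ.translation_invariant _ ((hA.preimage_add x).inter hU) x
  rw [image_preimage_inter] at h1 h2
  rw [evalHalfOpenCube, h1, h2]

theorem mem_image_unitCube {z : Fin d → ℤ} {x : E d} :
    x ∈ (fun y => y + latticeVec z) '' unitCube d ↔ ∀ i, (z i : ℝ) ≤ x i ∧ x i ≤ z i + 1 := by
  rw [image_add_right, mem_preimage]
  simp only [unitCube, mem_ofPred_eq, mem_Icc]
  refine forall_congr' fun i => ?_
  simp [← sub_eq_add_neg, add_comm]

theorem mem_image_upperBoundary {z : Fin d → ℤ} {x : E d} :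
    x ∈ (fun y => y + latticeVec z) '' upperBoundary d ↔
      (∀ i, (z i : ℝ) ≤ x i ∧ x i ≤ z i + 1) ∧ ∃ i, x i = z i + 1 := by
  rw [upperBoundary_eq_biUnion, image_add_right, mem_preimage]
  simp only [Finset.mem_univ, iUnion_true, mem_iUnion, upperFacet, mem_inter_iff, mem_ofPred_eq,
    exists_and_left]
  rw [← mem_image_unitCube, image_add_right, mem_preimage]
  refine and_congr_right fun _ => exists_congr fun i => ?_
  simp [← sub_eq_add_neg, sub_eq_iff_eq_add, add_comm]

/-- Remove a minimal `z` from the up-set `S`. Any other `w ∈ S` has some `w i ≥ z i + 1`, so its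
cube meets the cube of `z` only in the upper boundary. Conversely, a point of `A` on that boundary
has its floor vector above `z` and different from it, hence in the rest of `S`. Additivity therefore
splits off exactly the half-open cube at `z`. -/
theorem IsGeometricFunctional.biUnion_cubes {φ : Set (E d) → ℝ}
    (hφ : IsGeometricFunctional φ) {A : Set (E d)} (hA : IsPolyconvex A) {T : Finset (Fin d → ℤ)}
    (hT : ∀ x ∈ A, (fun i => ⌊x i⌋) ∈ T) (n : ℕ) : ∀ S : Finset (Fin d → ℤ), S.card = n →
      S ⊆ T → (∀ z ∈ S, ∀ w ∈ T, z ≤ w → w ∈ S) →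
      φ (⋃ z ∈ S, A ∩ (fun y => y + latticeVec z) '' unitCube d) =
        ∑ z ∈ S, evalHalfOpenCube φ ((fun y => y + latticeVec z) ⁻¹' A) := by
  classical
  have hcube : ∀ z : Fin d → ℤ,
      IsPolyconvex (A ∩ (fun y => y + latticeVec z) '' unitCube d) := fun z => by
    refine hA.inter ?_
    rw [image_add_right]
    exact (IsPolyconvex.of_convex (isCompact_unitCube d) (convex_unitCube d)).preimage_add _
  induction n with
  | zero =>
    intro S hS _ _
    rw [Finset.card_eq_zero] at hS
    subst hS
    simp [hφ.empty]
  | succ n ih =>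
    intro S hS hST hup
    obtain ⟨z, hz⟩ := S.exists_minimal (Finset.card_pos.1 (by omega))
    have hzS : z ∈ S := hz.1
    have hmin : ∀ w ∈ S, w ≤ z → w = z := fun w hw hwz => le_antisymm hwz (hz.2 hw hwz)
    have hS' : (S.erase z).card = n := by rw [Finset.card_erase_of_mem hzS]; omega
    have hup' : ∀ w ∈ S.erase z, ∀ v ∈ T, w ≤ v → v ∈ S.erase z := by
      intro w hw v hv hwv
      rw [Finset.mem_erase] at hw ⊢
      refine ⟨?_, hup w hw.2 v hv hwv⟩
      rintro rfl
      exact hw.1 (hmin w hw.2 hwv)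
    have key : (A ∩ (fun y => y + latticeVec z) '' unitCube d) ∩
        (⋃ w ∈ S.erase z, A ∩ (fun y => y + latticeVec w) '' unitCube d) =
        A ∩ (fun y => y + latticeVec z) '' upperBoundary d := by
      ext x
      simp only [mem_inter_iff, mem_iUnion, mem_image_unitCube, mem_image_upperBoundary,
        Finset.mem_erase, exists_prop]
      constructor
      · rintro ⟨⟨hxA, hxz⟩, w, ⟨hwz, hwS⟩, -, hxw⟩
        refine ⟨hxA, hxz, ?_⟩
        have : ¬ w ≤ z := fun h => hwz (hmin w hwS h)
        rw [Pi.le_def, not_forall] at this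
        obtain ⟨i, hi⟩ := this
        refine ⟨i, le_antisymm (hxz i).2 (le_trans ?_ (hxw i).1)⟩
        have : z i + 1 ≤ w i := by omega
        exact_mod_cast this
      · rintro ⟨hxA, hxz, i, hi⟩
        refine ⟨⟨hxA, hxz⟩, fun i => ⌊x i⌋, ⟨?_, ?_⟩, hxA, fun j =>
          ⟨Int.floor_le _, (Int.lt_floor_add_one _).le⟩⟩
        · intro h
          have h1 := congrFun h i
          simp only [hi] at h1
          rw [Int.floor_add_one, Int.floor_intCast] at h1
          omega
        · exact hup z hzS _ (hT x hxA) fun j => Int.le_floor.2 (hxz j).1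
    rw [← Finset.insert_erase hzS, Finset.set_biUnion_insert,
      Finset.sum_insert (Finset.notMem_erase z S),
      hφ.additive _ _ (hcube z) (IsPolyconvex.biUnion fun w _ => hcube w), key,
      ih _ hS' ((Finset.erase_subset z S).trans hST) hup', hφ.evalHalfOpenCube_preimage hA]
    ring

/-- A geometric functional is the sum of its contributions in the half-open lattice cubes. -/
theorem IsGeometricFunctional.eq_sum_evalHalfOpenCube {φ : Set (E d) → ℝ}
    (hφ : IsGeometricFunctional φ) {A : Set (E d)} (hA : IsPolyconvex A) {T : Finset (Fin d → ℤ)}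
    (hT : ∀ x ∈ A, (fun i => ⌊x i⌋) ∈ T) :
    φ A = ∑ z ∈ T, evalHalfOpenCube φ ((fun y => y + latticeVec z) ⁻¹' A) := by
  rw [← hφ.biUnion_cubes hA hT _ T rfl subset_rfl fun _ _ w hw _ => hw]
  congr 1
  ext x
  simp only [mem_iUnion, mem_inter_iff, mem_image_unitCube, exists_prop]
  exact ⟨fun h => ⟨_, hT x h, h, fun i => ⟨Int.floor_le _, (Int.lt_floor_add_one _).le⟩⟩,
    fun ⟨z, _, h, _⟩ => h⟩

end Cubes

/-! ### Suprema of kernels over balls -/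

section SupBall

variable {d : ℕ} {M : Type*} {g : M → E d → ℝ}

/-- The supremum of `g m` over the open ball with centre `z` and radius `ρ`. -/
noncomputable def supBall (g : M → E d → ℝ) (ρ : ℝ) (z : E d) (m : M) : ℝ≥0∞ :=
  ⨆ w ∈ Metric.ball z ρ, ENNReal.ofReal (g m w)

theorem ofReal_lt_supBall_iff {ρ c : ℝ} (hc : 0 ≤ c) {z : E d} {m : M} :
    ENNReal.ofReal c < supBall g ρ z m ↔ ∃ w ∈ Metric.ball z ρ, c < g m w := by
  simp only [supBall, lt_iSup_iff, exists_prop]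
  refine exists_congr fun w => and_congr_right fun _ => ?_
  rw [ENNReal.ofReal_lt_ofReal_iff_of_nonneg hc]

theorem le_supBall (m : M) {y z : E d} {ρ : ℝ} (h : dist y z < ρ) :
    ENNReal.ofReal (g m y) ≤ supBall g ρ z m :=
  le_iSup₂ (f := fun w (_ : w ∈ Metric.ball z ρ) => ENNReal.ofReal (g m w)) y h

/-- The marked points whose kernels do not vanish identically on the ball `B(0, R)`. -/
def hitting (g : M → E d → ℝ) (R : ℝ) : Set (E d × M) := {p | 0 < supBall g R (0 - p.1) p.2}

theorem mem_hitting_iff {R : ℝ} {p : E d × M} :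
    p ∈ hitting g R ↔ ∃ w ∈ Metric.ball (0 : E d) R, 0 < g p.2 (w - p.1) := by
  have := ofReal_lt_supBall_iff (g := g) (ρ := R) le_rfl (z := 0 - p.1) (m := p.2)
  rw [ENNReal.ofReal_zero] at this
  rw [hitting, mem_ofPred_eq, this]
  constructor
  · rintro ⟨w, hw, h⟩
    refine ⟨w + p.1, ?_, by simpa using h⟩
    rw [Metric.mem_ball, dist_eq_norm] at hw ⊢
    convert hw using 2
    abel
  · rintro ⟨w, hw, h⟩
    refine ⟨w - p.1, ?_, h⟩
    rw [Metric.mem_ball, dist_eq_norm] at hw ⊢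
    convert hw using 2
    abel

end SupBall

/-! ### Measurability of the kernels -/

section Kernel

variable {d : ℕ} {M : Type*} [MeasurableSpace M] {g : M → E d → ℝ}

namespace IsKernelFamily

theorem isConcaveBump (hg : IsKernelFamily g) (m : M) (x : E d) :
    IsConcaveBump ((fun y => y - x) ⁻¹' tsupport (g m)) fun y => g m (y - x) where
  isClosed := (isClosed_tsupport _).preimage (by fun_prop)
  convex := by
    simpa only [sub_eq_add_neg] using (hg.convex_support m).translate_preimage_left (-x)
  continuousOn := (hg.continuousOn m).comp (by fun_prop) fun _ h => h
  concaveOn := by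
    simpa only [sub_eq_add_neg, Function.comp_def, add_comm] using
      (hg.concaveOn m).translate_left (-x)
  nonneg y := hg.nonneg m _
  eq_zero y hy := image_eq_zero_of_notMem_tsupport hy

/-- Upper semicontinuity on the whole space: the kernel is continuous on its closed support and may
only drop to `0` outside it. -/
theorem eventually_lt (hg : IsKernelFamily g) (m : M) (y : E d) {ε : ℝ} (hε : 0 < ε) :
    ∀ᶠ w in 𝓝 y, g m w < g m y + ε := by
  have h0 := hg.nonneg m y
  by_cases hy : y ∈ tsupport (g m)
  · have h1 : ∀ᶠ w in 𝓝[tsupport (g m)] y, g m w < g m y + ε :=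
      (hg.continuousOn m y hy).eventually (gt_mem_nhds (by linarith))
    filter_upwards [eventually_nhdsWithin_iff.1 h1] with w hw
    by_cases hwK : w ∈ tsupport (g m)
    · exact hw hwK
    · rw [image_eq_zero_of_notMem_tsupport hwK]; linarith
  · filter_upwards [(isClosed_tsupport (g m)).isOpen_compl.mem_nhds hy] with w hw
    rw [image_eq_zero_of_notMem_tsupport hw]; linarith

theorem tsupport_subset_closure_interior (hg : IsKernelFamily g) (m : M) :
    tsupport (g m) ⊆ closure (interior (tsupport (g m))) := by
  have hne : (interior (tsupport (g m))).Nonempty := by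
    by_contra h
    rw [not_nonempty_iff_eq_empty] at h
    have h1 := (hg.convex_support m).addHaar_frontier volume
    rw [frontier, h, sdiff_empty, (isClosed_tsupport _).closure_eq] at h1
    exact (hg.volume_support_pos m).ne' h1
  rw [(hg.convex_support m).closure_interior_eq_closure_of_nonempty_interior hne]
  exact subset_closure

/-- Continuity holds only relative to the support, but the support is the closure of its interior,
so an open set of interior points near `w` still exceeds `c`. Hence suprema over balls are essential
suprema, visible to the `L¹` class. -/
theorem volume_superlevel_pos (hg : IsKernelFamily g) {m : M} {U : Set (E d)} (hU : IsOpen U)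
    {c : ℝ} (hc : 0 ≤ c) {w : E d} (hw : w ∈ U) (hgw : c < g m w) :
    0 < volume (U ∩ {x | c < g m x}) := by
  have hwK : w ∈ tsupport (g m) := subset_tsupport _ (by simpa using (hc.trans_lt hgw).ne')
  have h1 : ∀ᶠ x in 𝓝[tsupport (g m)] w, c < g m x :=
    (hg.continuousOn m w hwK).eventually (lt_mem_nhds hgw)
  rw [eventually_nhdsWithin_iff, eventually_nhds_iff] at h1
  obtain ⟨V, hV, hVo, hwV⟩ := h1
  obtain ⟨x, hx, hxi⟩ := mem_closure_iff.1 (hg.tsupport_subset_closure_interior m hwK) (U ∩ V)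
    (hU.inter hVo) ⟨hw, hwV⟩
  refine lt_of_lt_of_le (((hU.inter hVo).inter isOpen_interior).measure_pos volume ⟨x, hx, hxi⟩)
    (measure_mono ?_)
  rintro y ⟨⟨hyU, hyV⟩, hyi⟩
  exact ⟨hyU, hV y hyV (interior_subset hyi)⟩

end IsKernelFamily

/-- The weight `max (ρ - ‖x‖) 0`, positive exactly on the ball with radius `ρ`. -/
noncomputable def tent (ρ : ℝ) (x : E d) : ℝ := max (ρ - ‖x‖) 0

theorem continuous_tent (ρ : ℝ) : Continuous (tent ρ : E d → ℝ) := by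
  unfold tent; fun_prop

theorem tent_nonneg (ρ : ℝ) (x : E d) : 0 ≤ tent ρ x := le_max_right _ _

theorem tent_le {ρ : ℝ} (hρ : 0 ≤ ρ) (x : E d) : tent ρ x ≤ ρ :=
  max_le (by linarith [norm_nonneg x]) hρ

theorem tent_pos_iff {ρ : ℝ} {x : E d} : 0 < tent ρ x ↔ ‖x‖ < ρ := by
  simp [tent]

theorem norm_tent_mul_le {ρ c : ℝ} (hρ : 0 ≤ ρ) (hc : 0 ≤ c) (x : E d) (t : ℝ) :
    ‖tent ρ x * max (t - c) 0‖ ≤ ρ * ‖t‖ := by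
  rw [norm_mul, Real.norm_of_nonneg (tent_nonneg _ _), Real.norm_of_nonneg (le_max_right _ _)]
  refine mul_le_mul (tent_le hρ x) ?_ (le_max_right _ _) hρ
  exact max_le ((sub_le_self _ hc).trans (Real.le_norm_self t)) (norm_nonneg t)

/-- A regularised truncation of `f`, positive iff `f` exceeds `c` on a positive part of the ball. -/
noncomputable def tentIntegral (ρ c : ℝ) (z : E d) (f : E d → ℝ) : ℝ :=
  ∫ w, tent ρ (z - w) * max (f w - c) 0

theorem integrable_tent_mul {ρ c : ℝ} (hρ : 0 ≤ ρ) (hc : 0 ≤ c) (z : E d) {f : E d → ℝ}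
    (hf : Integrable f) : Integrable fun w => tent ρ (z - w) * max (f w - c) 0 := by
  refine (hf.norm.const_mul ρ).mono' ?_ (ae_of_all _ fun w => norm_tent_mul_le hρ hc _ _)
  refine ((continuous_tent ρ).comp (by fun_prop)).aestronglyMeasurable.mul ?_
  exact (hf.1.sub aestronglyMeasurable_const).sup aestronglyMeasurable_const

theorem continuous_tentIntegral_left {ρ c : ℝ} (hρ : 0 ≤ ρ) (hc : 0 ≤ c) {f : E d → ℝ}
    (hf : Integrable f) : Continuous fun z => tentIntegral ρ c z f := by
  refine continuous_of_dominated (bound := fun w => ρ * ‖f w‖)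
    (fun z => (integrable_tent_mul hρ hc z hf).1)
    (fun z => ae_of_all _ fun w => norm_tent_mul_le hρ hc _ _) (hf.norm.const_mul ρ)
    (ae_of_all _ fun w => ?_)
  exact ((continuous_tent ρ).comp (by fun_prop)).mul continuous_const

theorem continuous_tentIntegral_right {ρ c : ℝ} (hρ : 0 ≤ ρ) (hc : 0 ≤ c) (z : E d) :
    Continuous fun f : E d →₁[volume] ℝ => tentIntegral ρ c z f := by
  refine (LipschitzWith.of_dist_le_mul (K := ρ.toNNReal) fun f f' => ?_).continuous
  rw [Real.coe_toNNReal _ hρ, dist_eq_norm, dist_eq_norm, L1.norm_eq_integral_norm,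
    ← integral_const_mul, tentIntegral, tentIntegral,
    ← integral_sub (integrable_tent_mul hρ hc z (L1.integrable_coeFn f))
      (integrable_tent_mul hρ hc z (L1.integrable_coeFn f'))]
  refine norm_integral_le_of_norm_le ((L1.integrable_coeFn (f - f')).norm.const_mul ρ) ?_
  filter_upwards [Lp.coeFn_sub f f'] with w hw
  rw [hw, ← mul_sub, norm_mul, Real.norm_of_nonneg (tent_nonneg _ _)]
  refine mul_le_mul (tent_le hρ _) ?_ (norm_nonneg _) hρ
  refine (abs_max_sub_max_le_abs _ _ _).trans_eq ?_
  rw [sub_sub_sub_cancel_right]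
  rfl

/-! ### Joint measurability of local suprema and of the kernels. -/

namespace IsKernelFamily

/-- A Carathéodory function: continuous in the centre, and measurable in the mark as an
`L¹`-continuous functional of the kernel. -/
theorem measurable_tentIntegral (hg : IsKernelFamily g) {ρ c : ℝ} (hρ : 0 ≤ ρ) (hc : 0 ≤ c) :
    Measurable fun p : E d × M => tentIntegral ρ c p.1 (g p.2) := by
  refine measurable_uncurry_of_continuous_of_measurable (u := fun z m => tentIntegral ρ c z (g m))
    (fun m => continuous_tentIntegral_left hρ hc (hg.integrable m)) fun z => ?_
  let : MeasurableSpace (E d →₁[volume] ℝ) := borel _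
  have : BorelSpace (E d →₁[volume] ℝ) := ⟨rfl⟩
  have h := (continuous_tentIntegral_right hρ hc z).measurable.comp hg.measurable_L1
  convert h using 2 with m
  refine integral_congr_ae ?_
  filter_upwards [(hg.integrable m).coeFn_toL1] with w hw
  rw [hw]

theorem tentIntegral_pos_iff (hg : IsKernelFamily g) {ρ c : ℝ} (hρ : 0 ≤ ρ) (hc : 0 ≤ c)
    {z : E d} {m : M} :
    0 < tentIntegral ρ c z (g m) ↔ ∃ w ∈ Metric.ball z ρ, c < g m w := by
  rw [tentIntegral, integral_pos_iff_support_of_nonneg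
    (fun w => mul_nonneg (tent_nonneg _ _) (le_max_right _ _))
    (integrable_tent_mul hρ hc z (hg.integrable m))]
  have hsupp : (Function.support fun w => tent ρ (z - w) * max (g m w - c) 0) =
      Metric.ball z ρ ∩ {w | c < g m w} := by
    ext w
    have h1 : tent ρ (z - w) ≠ 0 ↔ ‖z - w‖ < ρ := by
      rw [← tent_pos_iff, (tent_nonneg ρ (z - w)).lt_iff_ne']
    have h2 : max (g m w - c) 0 ≠ 0 ↔ c < g m w := by
      rw [← (le_max_right (g m w - c) 0).lt_iff_ne']
      simp
    simp only [Function.mem_support, mul_ne_zero_iff, h1, h2, mem_inter_iff, Metric.mem_ball,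
      mem_ofPred_eq, dist_eq_norm, norm_sub_rev]
  rw [hsupp]
  constructor
  · intro h
    obtain ⟨w, hw, hw'⟩ := nonempty_of_measure_ne_zero h.ne'
    exact ⟨w, hw, hw'⟩
  · rintro ⟨w, hw, hw'⟩
    exact hg.volume_superlevel_pos Metric.isOpen_ball hc hw hw'

theorem measurable_supBall (hg : IsKernelFamily g) {ρ : ℝ} (hρ : 0 ≤ ρ) :
    Measurable fun p : E d × M => supBall g ρ p.1 p.2 := by
  refine measurable_of_Ioi fun a => ?_
  by_cases ha : a = ∞
  · simp [ha]
  · have : (fun p : E d × M => supBall g ρ p.1 p.2) ⁻¹' Ioi a =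
        (fun p : E d × M => tentIntegral ρ a.toReal p.1 (g p.2)) ⁻¹' Ioi 0 := by
      ext p
      simp only [mem_preimage, mem_Ioi]
      rw [hg.tentIntegral_pos_iff hρ ENNReal.toReal_nonneg,
        ← ofReal_lt_supBall_iff ENNReal.toReal_nonneg, ENNReal.ofReal_toReal ha]
    rw [this]
    exact hg.measurable_tentIntegral hρ ENNReal.toReal_nonneg measurableSet_Ioi

theorem eventually_supBall_le (hg : IsKernelFamily g) (m : M) (y : E d) {ε : ℝ} (hε : 0 < ε) :
    ∃ δ > 0, ∀ z ρ, dist z y + ρ ≤ δ → supBall g ρ z m ≤ ENNReal.ofReal (g m y + ε) := by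
  obtain ⟨δ, hδ, h⟩ := Metric.eventually_nhds_iff.1 (hg.eventually_lt m y hε)
  refine ⟨δ, hδ, fun z ρ hz => iSup₂_le fun w hw => ENNReal.ofReal_le_ofReal (h ?_).le⟩
  rw [Metric.mem_ball] at hw
  linarith [dist_triangle w z y]

/-- Upper semicontinuity recovers point values from suprema over shrinking balls; this yields joint
measurability in position and mark from the `L¹` assumption. -/
theorem iInf_supBall (hg : IsKernelFamily g) (m : M) (y : E d) :
    ENNReal.ofReal (g m y) = ⨅ n : ℕ, supBall g (1 / ((n : ℝ) + 1)) y m := by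
  refine le_antisymm (le_iInf fun n => le_supBall m (by rw [dist_self]; positivity)) ?_
  refine ENNReal.le_of_forall_pos_le_add fun ε hε _ => ?_
  obtain ⟨δ, hδ, h⟩ := hg.eventually_supBall_le m y (ε := ε) (by exact_mod_cast hε)
  obtain ⟨n, hn⟩ := exists_nat_one_div_lt hδ
  refine (iInf_le _ n).trans ((h y _ (by rw [dist_self, zero_add]; exact hn.le)).trans ?_)
  exact ENNReal.ofReal_add_le.trans_eq (by rw [ENNReal.ofReal_coe_nnreal])

theorem measurable_ofReal (hg : IsKernelFamily g) :
    Measurable fun p : E d × M => ENNReal.ofReal (g p.2 p.1) := by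
  simp_rw [fun p : E d × M => hg.iInf_supBall p.2 p.1]
  exact Measurable.iInf fun n => hg.measurable_supBall (by positivity)

theorem measurable_ofReal_sub (hg : IsKernelFamily g) (y : E d) :
    Measurable fun p : E d × M => ENNReal.ofReal (g p.2 (y - p.1)) :=
  hg.measurable_ofReal.comp (f := fun p : E d × M => (y - p.1, p.2))
    ((measurable_fst.const_sub y).prodMk measurable_snd)

theorem measurable_supBall_sub (hg : IsKernelFamily g) {ρ : ℝ} (hρ : 0 ≤ ρ) (y : E d) :
    Measurable fun p : E d × M => supBall g ρ (y - p.1) p.2 :=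
  (hg.measurable_supBall hρ).comp (f := fun p : E d × M => (y - p.1, p.2))
    ((measurable_fst.const_sub y).prodMk measurable_snd)

end IsKernelFamily

/-! ### Finite intensity of the kernels hitting a ball. -/

namespace IsKernelFamily

theorem measurableSet_hitting (hg : IsKernelFamily g) {R : ℝ} (hR : 0 ≤ R) :
    MeasurableSet (hitting g R) :=
  hg.measurable_supBall_sub hR 0 measurableSet_Ioi

theorem eq_zero_of_notMem_hitting (hg : IsKernelFamily g) {R : ℝ} {p : E d × M}
    (hp : p ∉ hitting g R) {y : E d} (hy : y ∈ Metric.ball (0 : E d) R) :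
    g p.2 (y - p.1) = 0 := by
  rw [mem_hitting_iff] at hp
  push Not at hp
  exact le_antisymm (hp y hy) (hg.nonneg _ _)

theorem nonempty_tsupport (hg : IsKernelFamily g) (m : M) : (tsupport (g m)).Nonempty :=
  nonempty_of_measure_ne_zero (hg.volume_support_pos m).ne'

theorem measure_hitting_lt_top (hg : IsKernelFamily g) {Q : Measure M} [IsProbabilityMeasure Q]
    (γ : ℝ≥0) (hmoment : ∀ i : Fin (d + 1), 1 ≤ (i : ℕ) →
      Integrable (fun m => intrinsicVolume i (tsupport (g m))) Q) {R : ℝ} (hR : 0 ≤ R) :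
    (γ • (volume : Measure (E d)).prod Q) (hitting g R) < ∞ := by
  rw [Measure.smul_apply, Measure.prod_apply_symm (hg.measurableSet_hitting hR)]
  refine ENNReal.mul_lt_top ENNReal.coe_lt_top ?_
  have hint := integrable_volume_add_closedBall hg.nonempty_tsupport hg.compact_support
    hg.convex_support hmoment hR
  refine lt_of_le_of_lt (lintegral_mono fun m => ?_) hint.lintegral_lt_top
  have hc := (hg.compact_support m).add (isCompact_closedBall (0 : E d) R)
  -- A kernel placed at `x` hits the ball only if `-x` lies in the parallel body of its support,
  -- hence the reflection.
  rw [Measure.real, ENNReal.ofReal_toReal hc.measure_lt_top.ne, ← Measure.measure_neg]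
  refine measure_mono fun x hx => ?_
  obtain ⟨w, hw, h⟩ := mem_hitting_iff.1 hx
  refine ⟨w + x, subset_tsupport _ (by simpa using h.ne'), -w, ?_, by simp⟩
  rw [mem_closedBall_zero_iff, norm_neg]
  exact (mem_ball_zero_iff.1 hw).le

end IsKernelFamily

end Kernel

/-! ### Poisson processes -/

/-- The atom of the algebra generated by the sets `C k` which lies in `C k` exactly for `k ∈ s`. -/
def atom {X κ : Type*} (C : κ → Set X) (s : Finset κ) : Set X := {x | ∀ k, x ∈ C k ↔ k ∈ s}

theorem disjoint_atom {X κ : Type*} (C : κ → Set X) {s t : Finset κ} (h : s ≠ t) :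
    Disjoint (atom C s) (atom C t) := by
  rw [Set.disjoint_left]
  intro x hs ht
  exact h (Finset.ext fun k => (hs k).symm.trans (ht k))

namespace IsPoissonProcess

variable {Ω Ω' X : Type*} [MeasurableSpace Ω] [MeasurableSpace Ω'] [MeasurableSpace X]
  {P : Measure Ω} {P' : Measure Ω'} {Λ : Measure X} {η : Ω → Measure X} {η' : Ω' → Measure X}

theorem measurable_apply (h : IsPoissonProcess P Λ η) {B : Set X} (hB : MeasurableSet B) :
    Measurable fun ω => η ω B :=
  (Measure.measurable_coe hB).comp h.measurable

theorem map_apply_eq [IsProbabilityMeasure P] [IsProbabilityMeasure P']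
    (h : IsPoissonProcess P Λ η) (h' : IsPoissonProcess P' Λ η')
    {B : Set X} (hB : MeasurableSet B) :
    P.map (fun ω => η ω B) = P'.map (fun ω => η' ω B) := by
  by_cases hΛ : Λ B = ∞
  · have e : (fun ω => η ω B) =ᵐ[P] fun _ => ∞ := h.infinite B hB hΛ
    have e' : (fun ω => η' ω B) =ᵐ[P'] fun _ => ∞ := h'.infinite B hB hΛ
    rw [Measure.map_congr e, Measure.map_congr e']
    simp
  · rw [h.poisson B hB hΛ, h'.poisson B hB hΛ]

theorem map_pi_eq_of_disjoint [IsProbabilityMeasure P] [IsProbabilityMeasure P']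
    (h : IsPoissonProcess P Λ η) (h' : IsPoissonProcess P' Λ η')
    {n : ℕ} {B : Fin n → Set X} (hB : ∀ i, MeasurableSet (B i))
    (hd : Pairwise fun i j => Disjoint (B i) (B j)) :
    P.map (fun ω i => η ω (B i)) = P'.map (fun ω i => η' ω (B i)) := by
  rw [(iIndepFun_iff_map_fun_eq_pi_map fun i => (h.measurable_apply (hB i)).aemeasurable).1
      (h.independent n B hB hd),
    (iIndepFun_iff_map_fun_eq_pi_map fun i => (h'.measurable_apply (hB i)).aemeasurable).1
      (h'.independent n B hB hd)]
  simp_rw [fun i => h.map_apply_eq h' (hB i)]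

theorem measurableSet_atom {κ : Type*} [Finite κ] {C : κ → Set X}
    (hC : ∀ k, MeasurableSet (C k)) (s : Finset κ) : MeasurableSet (atom C s) := by
  rw [atom, ofPred_forall]
  refine MeasurableSet.iInter fun k => ?_
  by_cases hk : k ∈ s
  · simpa [hk] using hC k
  · simp only [hk, iff_false]
    exact (hC k).compl

theorem measure_eq_sum_atom {κ : Type*} [Fintype κ] [DecidableEq κ] {C : κ → Set X}
    (hC : ∀ k, MeasurableSet (C k)) (μ : Measure X) (k : κ) :
    μ (C k) = ∑ s : Finset κ, if k ∈ s then μ (atom C s) else 0 := by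
  have e : C k = ⋃ s ∈ (Finset.univ : Finset (Finset κ)).filter (k ∈ ·), atom C s := by
    classical
    ext x
    simp only [Finset.mem_filter, Finset.mem_univ, true_and, mem_iUnion, exists_prop]
    constructor
    · intro hx
      exact ⟨Finset.univ.filter (x ∈ C ·), by simpa using hx, fun j => by simp⟩
    · rintro ⟨s, hs, hx⟩
      exact (hx k).2 hs
  conv_lhs => rw [e]
  rw [measure_biUnion_finset (fun s _ t _ hst => disjoint_atom C hst)
    (fun s _ => measurableSet_atom hC s), Finset.sum_filter]

/-- Overlapping sets are unions of atoms of the finite algebra they generate; the counts are sums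
over these disjoint atoms, where independence applies. -/
theorem map_pi_eq [IsProbabilityMeasure P] [IsProbabilityMeasure P']
    (h : IsPoissonProcess P Λ η) (h' : IsPoissonProcess P' Λ η')
    {κ : Type*} [Fintype κ] {C : κ → Set X} (hC : ∀ k, MeasurableSet (C k)) :
    P.map (fun ω k => η ω (C k)) = P'.map (fun ω k => η' ω (C k)) := by
  classical
  let e := Fintype.equivFin (Finset κ)
  let S : (Fin (Fintype.card (Finset κ)) → ℝ≥0∞) → κ → ℝ≥0∞ := fun a k =>
    ∑ s : Finset κ, if k ∈ s then a (e s) else 0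
  have hS : Measurable S := by
    refine measurable_pi_lambda _ fun k => Finset.measurable_fun_sum _ fun s _ => ?_
    split_ifs
    · exact measurable_pi_apply _
    · exact measurable_const
  have hm : ∀ i, MeasurableSet (atom C (e.symm i)) := fun i => measurableSet_atom hC _
  have hd : Pairwise fun i j => Disjoint (atom C (e.symm i)) (atom C (e.symm j)) :=
    fun i j hij => disjoint_atom C (e.symm.injective.ne hij)
  have hη : (fun ω k => η ω (C k)) = S ∘ fun ω i => η ω (atom C (e.symm i)) := by
    ext ω k
    simp [S, ← measure_eq_sum_atom hC]
  have hη' : (fun ω k => η' ω (C k)) = S ∘ fun ω i => η' ω (atom C (e.symm i)) := by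
    ext ω k
    simp [S, ← measure_eq_sum_atom hC]
  rw [hη, hη', ← Measure.map_map hS (measurable_pi_lambda _ fun i => h.measurable_apply (hm i)),
    ← Measure.map_map hS (measurable_pi_lambda _ fun i => h'.measurable_apply (hm i)),
    h.map_pi_eq_of_disjoint h' hm hd]

/-- The law of a Poisson process is determined by its intensity measure. -/
theorem map_eq [IsProbabilityMeasure P] [IsProbabilityMeasure P']
    (h : IsPoissonProcess P Λ η) (h' : IsPoissonProcess P' Λ η') : P.map η = P'.map η' := by
  let ev : Measure X → {B : Set X // MeasurableSet B} → ℝ≥0∞ := fun μ B => μ B.1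
  have hev : Measurable ev := measurable_pi_lambda _ fun B => Measure.measurable_coe B.2
  -- The `σ`-algebra on measures is pulled back from a product along evaluations, so
  -- finite-dimensional laws decide.
  have hcomap : (inferInstance : MeasurableSpace (Measure X)) = MeasurableSpace.comap ev
      MeasurableSpace.pi := by
    refine le_antisymm ?_ hev.comap_le
    refine iSup₂_le fun B hB => ?_
    rw [MeasurableSpace.comap_le_iff_le_map]
    intro t ht
    exact ⟨(fun a => a ⟨B, hB⟩) ⁻¹' t, measurable_pi_apply _ ht, rfl⟩
  have hfin : ∀ J : Finset {B : Set X // MeasurableSet B},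
      ((P.map η).map ev).map J.restrict = ((P'.map η').map ev).map J.restrict := by
    intro J
    rw [Measure.map_map hev h.measurable, Measure.map_map hev h'.measurable,
      Measure.map_map (Finset.measurable_restrict J) (hev.comp h.measurable),
      Measure.map_map (Finset.measurable_restrict J) (hev.comp h'.measurable)]
    exact h.map_pi_eq h' (C := fun B : J => B.1.1) fun B => B.1.2
  have hprob : IsProbabilityMeasure ((P'.map η').map ev) := by
    have := Measure.isProbabilityMeasure_map (μ := P') h'.measurable.aemeasurable
    exact Measure.isProbabilityMeasure_map hev.aemeasurable
  have hlim : (P.map η).map ev = (P'.map η').map ev := by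
    have : ∀ J : Finset {B : Set X // MeasurableSet B},
        IsFiniteMeasure (((P'.map η').map ev).map J.restrict) := fun J => inferInstance
    exact IsProjectiveLimit.unique
      (P := fun J : Finset {B : Set X // MeasurableSet B} => ((P'.map η').map ev).map J.restrict)
      hfin fun J => rfl
  ext s hs
  have hs' : MeasurableSet[MeasurableSpace.comap ev MeasurableSpace.pi] s := by
    rw [← hcomap]; exact hs
  obtain ⟨t, ht, rfl⟩ := hs'
  rw [← Measure.map_apply hev ht, ← Measure.map_apply hev ht, hlim]

theorem map_measurePreserving (h : IsPoissonProcess P Λ η) {T : X → X}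
    (hT : MeasurePreserving T Λ Λ) : IsPoissonProcess P Λ fun ω => (η ω).map T where
  measurable := (Measure.measurable_map T hT.measurable).comp h.measurable
  counting := by
    filter_upwards [h.counting] with ω hω
    obtain ⟨ι, hι, x, hx⟩ := hω
    refine ⟨ι, hι, fun i => T (x i), ?_⟩
    rw [hx, Measure.map_sum hT.measurable.aemeasurable]
    simp_rw [Measure.map_dirac' hT.measurable]
  poisson B hB hΛ := by
    have := h.poisson (T ⁻¹' B) (hT.measurable hB)
    rw [hT.measure_preimage hB.nullMeasurableSet] at this
    simp_rw [Measure.map_apply hT.measurable hB]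
    exact this hΛ
  infinite B hB hΛ := by
    have := h.infinite (T ⁻¹' B) (hT.measurable hB)
    rw [hT.measure_preimage hB.nullMeasurableSet] at this
    simp_rw [Measure.map_apply hT.measurable hB]
    exact this hΛ
  independent n B hB hd := by
    have := h.independent n (fun i => T ⁻¹' B i) (fun i => hT.measurable (hB i))
      fun i j hij => (hd hij).preimage T
    simp_rw [Measure.map_apply hT.measurable (hB _)]
    exact this

theorem ae_lt_top (h : IsPoissonProcess P Λ η) {B : Set X} (hB : MeasurableSet B)
    (hΛ : Λ B ≠ ∞) : ∀ᵐ ω ∂P, η ω B < ∞ := by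
  have h1 : ∀ᵐ a ∂P.map (fun ω => η ω B), a < ∞ := by
    rw [h.poisson B hB hΛ, ae_map_iff .of_discrete measurableSet_Iio]
    exact ae_of_all _ fun n => ENNReal.natCast_lt_top n
  exact ae_of_ae_map (h.measurable_apply hB).aemeasurable h1

theorem integrable_rpow (h : IsPoissonProcess P Λ η) {B : Set X} (hB : MeasurableSet B)
    (hΛ : Λ B ≠ ∞) : Integrable (fun ω => (3 : ℝ) ^ (η ω B).toReal) P := by
  have hm : Measurable fun a : ℝ≥0∞ => (3 : ℝ) ^ a.toReal :=
    measurable_const.pow ENNReal.measurable_toReal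
  have h1 : Integrable (fun a : ℝ≥0∞ => (3 : ℝ) ^ a.toReal) (P.map fun ω => η ω B) := by
    rw [h.poisson B hB hΛ, integrable_map_measure hm.aestronglyMeasurable .of_discrete,
      integrable_poissonMeasure_iff]
    set r := (Λ B).toNNReal
    refine ((Real.summable_pow_div_factorial ((r : ℝ) * 3)).mul_left (Real.exp (-r))).congr
      fun n => ?_
    simp only [Function.comp_apply, ENNReal.toReal_natCast, Real.rpow_natCast]
    rw [Real.norm_of_nonneg (by positivity), mul_pow]
    ring
  exact h1.comp_measurable (h.measurable_apply hB)

end IsPoissonProcess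

/-! ### Excursion sets of locally finite configurations -/

section Excursion

variable {d : ℕ} {M : Type*} [MeasurableSpace M] {g : M → E d → ℝ}

/-- Counting measures with finitely many kernels hitting each bounded set. -/
structure IsLocallyFiniteConfig (g : M → E d → ℝ) (μ : Measure (E d × M)) : Prop where
  counting : IsCountingMeasure μ
  hitting_lt_top : ∀ n : ℕ, μ (hitting g n) < ∞

/-- Every index whose point lies in `A` adds mass `1`, so only finitely many do. Indexing by `ι`
rather than by points keeps multiplicities. -/
theorem IsCountingMeasure.exists_finset {X : Type*} [MeasurableSpace X] {μ : Measure X}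
    (hμ : IsCountingMeasure μ) {A : Set X} (hA : MeasurableSet A) (hfin : μ A < ∞) :
    ∃ (ι : Type) (s : Finset ι) (x : ι → X),
      ∀ f : X → ℝ≥0∞, Measurable f → ∫⁻ p in A, f p ∂μ = ∑ i ∈ s, f (x i) := by
  classical
  obtain ⟨ι, hι, x, rfl⟩ := hμ
  have hlint : ∀ f : X → ℝ≥0∞, Measurable f →
      ∫⁻ p in A, f p ∂(Measure.sum fun i => Measure.dirac (x i)) =
        ∑' i, A.indicator f (x i) := by
    intro f hf
    rw [← lintegral_indicator hA, lintegral_sum_measure]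
    simp_rw [lintegral_dirac' _ (hf.indicator hA)]
  have h1 := hlint (fun _ => 1) measurable_const
  rw [setLIntegral_one] at h1
  have hne : ∑' i, A.indicator (fun _ => (1 : ℝ≥0∞)) (x i) ≠ ∞ := by rw [← h1]; exact hfin.ne
  have hs : {i | x i ∈ A}.Finite := by
    refine (ENNReal.finite_const_le_of_tsum_ne_top hne one_ne_zero).subset fun i hi => ?_
    have hi : x i ∈ A := hi
    simp [hi]
  refine ⟨ι, hs.toFinset, x, fun f hf => ?_⟩
  rw [hlint f hf, tsum_eq_sum (s := hs.toFinset)]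
  · refine Finset.sum_congr rfl fun i hi => ?_
    have hi : x i ∈ A := by simpa using hi
    simp [hi]
  · intro i hi
    have hi : x i ∉ A := by simpa using hi
    simp [hi]

theorem IsKernelFamily.shotNoise_eq_setLIntegral (hg : IsKernelFamily g) (μ : Measure (E d × M))
    {R : ℝ} {y : E d} (hy : y ∈ Metric.ball (0 : E d) R) :
    shotNoise g μ y = ∫⁻ p in hitting g R, ENNReal.ofReal (g p.2 (y - p.1)) ∂μ := by
  have hR : 0 ≤ R := (Metric.pos_of_mem_ball hy).le
  rw [shotNoise, ← lintegral_indicator (hg.measurableSet_hitting hR)]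
  refine lintegral_congr fun p => ?_
  by_cases hp : p ∈ hitting g R
  · rw [indicator_of_mem hp]
  · rw [indicator_of_notMem hp, hg.eq_zero_of_notMem_hitting hp hy, ENNReal.ofReal_zero]

namespace IsLocallyFiniteConfig

variable {μ : Measure (E d × M)}

/-- In the ball only the finitely many hitting kernels matter, which reduces excursion sets to level
sets of finite sums. The cardinality is recorded because it is the exponent in the `3 ^ n` bound. -/
theorem exists_levelSet (hμ : IsLocallyFiniteConfig g μ) (hg : IsKernelFamily g) {u : ℝ}
    (n : ℕ) : ∃ (ι : Type) (s : Finset ι) (K : ι → Set (E d)) (k : ι → E d → ℝ),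
      (∀ i, IsConcaveBump (K i) (k i)) ∧ μ (hitting g n) = s.card ∧
      ∀ D ⊆ Metric.ball (0 : E d) n,
        excursionSet g u μ ∩ D = {y ∈ D | u ≤ ∑ i ∈ s, k i y} := by
  obtain ⟨ι, s, x, hx⟩ := hμ.counting.exists_finset
    (hg.measurableSet_hitting (Nat.cast_nonneg n)) (hμ.hitting_lt_top n)
  refine ⟨ι, s, fun i => (fun y => y - (x i).1) ⁻¹' tsupport (g (x i).2),
    fun i y => g (x i).2 (y - (x i).1), fun i => hg.isConcaveBump _ _, ?_, fun D hD => ?_⟩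
  · rw [← setLIntegral_one, hx _ measurable_const]
    simp
  · ext y
    simp only [mem_inter_iff, mem_ofPred_eq, excursionSet]
    rw [and_comm]
    refine and_congr_right fun hy => ?_
    rw [hg.shotNoise_eq_setLIntegral μ (hD hy), hx _ (hg.measurable_ofReal_sub y),
      ← ENNReal.ofReal_sum_of_nonneg fun i _ => hg.nonneg _ _,
      ENNReal.ofReal_le_ofReal_iff (Finset.sum_nonneg fun i _ => hg.nonneg _ _)]

theorem isPolyconvex_inter (hμ : IsLocallyFiniteConfig g μ) (hg : IsKernelFamily g) (u : ℝ)
    {D : Set (E d)} (hD : IsCompact D) (hDc : Convex ℝ D) :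
    IsPolyconvex (excursionSet g u μ ∩ D) := by
  obtain ⟨R, hR⟩ := hD.isBounded.subset_ball 0
  obtain ⟨n, hn⟩ := exists_nat_ge R
  obtain ⟨ι, s, K, k, hk, -, h⟩ := hμ.exists_levelSet hg (u := u) n
  rw [h D (hR.trans (Metric.ball_subset_ball hn))]
  exact isPolyconvex_levelSet hk u s hD hDc

theorem unitCube_subset_ball (d : ℕ) : unitCube d ⊆ Metric.ball (0 : E d) (d + 1 : ℕ) := by
  intro x hx
  rw [mem_ball_zero_iff, EuclideanSpace.norm_eq, Real.sqrt_lt' (by positivity)]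
  calc ∑ i, ‖x i‖ ^ 2 ≤ ∑ i : Fin d, (1 : ℝ) := by
        refine Finset.sum_le_sum fun i _ => ?_
        have := hx i
        rw [Real.norm_of_nonneg this.1]
        exact pow_le_one₀ this.1 this.2
    _ < _ := by
        simp
        nlinarith [Nat.cast_nonneg (α := ℝ) d]

theorem abs_le (hμ : IsLocallyFiniteConfig g μ) (hg : IsKernelFamily g) (u : ℝ)
    {φ : Set (E d) → ℝ} (hφ : IsGeometricFunctional φ) {C : ℝ}
    (hC : ∀ A : Set (E d), IsCompact A → Convex ℝ A → A ⊆ unitCube d → |φ A| ≤ C)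
    {D : Set (E d)} (hD : IsCompact D) (hDc : Convex ℝ D) (hDC : D ⊆ unitCube d) :
    |φ (excursionSet g u μ ∩ D)| ≤ 3 ^ (μ (hitting g (d + 1 : ℕ))).toReal * C := by
  obtain ⟨ι, s, K, k, hk, hs, h⟩ := hμ.exists_levelSet hg (u := u) (d + 1)
  rw [h D (hDC.trans (unitCube_subset_ball d)), hs, ENNReal.toReal_natCast, Real.rpow_natCast]
  exact hφ.abs_levelSet_le hC hk u s hD hDc hDC

/-- An excursion set hits a compact set `C` iff all its approximations from above, based on suprema
of the kernels over small balls, do so at points of a fixed dense subset. -/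
theorem nonempty_inter_iff (hμ : IsLocallyFiniteConfig g μ) (hg : IsKernelFamily g) {u : ℝ}
    {C t : Set (E d)} (hC : IsCompact C) (htC : t ⊆ C) (ht : C ⊆ closure t)
    {n : ℕ} (hCn : C ⊆ Metric.ball (0 : E d) n) :
    (excursionSet g u μ ∩ C).Nonempty ↔ ∀ k : ℕ, ∃ y ∈ t, ENNReal.ofReal u ≤
      ∫⁻ p in hitting g n, supBall g (1 / ((k : ℝ) + 1)) (y - p.1) p.2 ∂μ := by
  constructor
  · rintro ⟨y₀, hy₀, hy₀C⟩ k
    obtain ⟨y, hy, hyt⟩ := Metric.mem_closure_iff.1 (ht hy₀C) (1 / ((k : ℝ) + 1)) (by positivity)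
    refine ⟨y, hy, le_trans hy₀ ?_⟩
    rw [hg.shotNoise_eq_setLIntegral μ (hCn hy₀C)]
    refine lintegral_mono fun p => le_supBall _ ?_
    rwa [dist_sub_right]
  · intro h
    obtain ⟨ι, s, x, hx⟩ := hμ.counting.exists_finset
      (hg.measurableSet_hitting (Nat.cast_nonneg n)) (hμ.hitting_lt_top n)
    choose y hyt hy using h
    obtain ⟨y₀, hy₀, σ, hσ, hlim⟩ := hC.tendsto_subseq fun k => htC (hyt k)
    refine ⟨y₀, ?_, hy₀⟩
    rw [excursionSet, mem_ofPred_eq, hg.shotNoise_eq_setLIntegral μ (hCn hy₀),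
      hx _ (hg.measurable_ofReal_sub y₀)]
    refine ENNReal.le_of_forall_pos_le_add fun ε hε _ => ?_
    -- Each of the `s.card` kernels may exceed its limit value by `δ`, for a total below `ε`; the `+
    -- 1` covers the empty sum.
    set δ : ℝ := ε / (s.card + 1) with hδ
    have hδ0 : 0 < δ := by positivity
    have hev : ∀ i ∈ s, ∀ᶠ k in atTop,
        supBall g (1 / ((σ k : ℝ) + 1)) (y (σ k) - (x i).1) (x i).2 ≤
          ENNReal.ofReal (g (x i).2 (y₀ - (x i).1) + δ) := by
      intro i _
      obtain ⟨ρ, hρ, hρ'⟩ := hg.eventually_supBall_le (x i).2 (y₀ - (x i).1) hδ0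
      have h1 : Tendsto (fun k => dist (y (σ k)) y₀ + 1 / ((σ k : ℝ) + 1)) atTop (𝓝 (0 + 0)) :=
        (tendsto_iff_dist_tendsto_zero.1 hlim).add
          (tendsto_one_div_add_atTop_nhds_zero_nat.comp hσ.tendsto_atTop)
      rw [add_zero] at h1
      filter_upwards [h1.eventually (gt_mem_nhds hρ)] with k hk
      refine hρ' _ _ ?_
      rw [dist_sub_right]
      exact hk.le
    obtain ⟨k, hk⟩ := ((Finset.eventually_all s).2 hev).exists
    refine (hy (σ k)).trans ?_
    rw [hx _ (hg.measurable_supBall_sub (by positivity) _)]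
    refine (Finset.sum_le_sum hk).trans ?_
    calc _ ≤ ∑ i ∈ s, (ENNReal.ofReal (g (x i).2 (y₀ - (x i).1)) + ENNReal.ofReal δ) :=
          Finset.sum_le_sum fun i _ => ENNReal.ofReal_add_le
      _ ≤ _ := by
          rw [Finset.sum_add_distrib]
          gcongr
          rw [Finset.sum_const, nsmul_eq_mul, ← ENNReal.ofReal_natCast,
            ← ENNReal.ofReal_mul (by positivity), ← ENNReal.ofReal_coe_nnreal]
          refine ENNReal.ofReal_le_ofReal ?_
          rw [hδ, mul_div_assoc', div_le_iff₀ (by positivity)]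
          nlinarith [ε.2, NNReal.coe_nonneg ε]

end IsLocallyFiniteConfig

theorem IsKernelFamily.exists_measurableSet_hits_compact (hg : IsKernelFamily g) (u : ℝ)
    {C : Set (E d)} (hC : IsCompact C) : ∃ H : Set (Measure (E d × M)), MeasurableSet H ∧
      ∀ μ, IsLocallyFiniteConfig g μ → (μ ∈ H ↔ (excursionSet g u μ ∩ C).Nonempty) := by
  obtain ⟨R, hR⟩ := hC.isBounded.subset_ball 0
  obtain ⟨n, hn⟩ := exists_nat_ge R
  obtain ⟨t, htC, htc, ht⟩ :=
    (TopologicalSpace.IsSeparable.of_separableSpace C).exists_countable_dense_subset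
  refine ⟨⋂ k : ℕ, ⋃ y ∈ t, {μ | ENNReal.ofReal u ≤
      ∫⁻ p in hitting g n, supBall g (1 / ((k : ℝ) + 1)) (y - p.1) p.2 ∂μ}, ?_, fun μ hμ => ?_⟩
  · refine MeasurableSet.iInter fun k => MeasurableSet.biUnion htc fun y _ => ?_
    refine measurableSet_le measurable_const ?_
    have hm := hg.measurableSet_hitting (Nat.cast_nonneg (α := ℝ) n)
    simp_rw [← lintegral_indicator hm]
    exact Measure.measurable_lintegral
      ((hg.measurable_supBall_sub (by positivity) y).indicator hm)
  · rw [hμ.nonempty_inter_iff hg hC htC ht (hR.trans (Metric.ball_subset_ball hn))]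
    simp

theorem IsKernelFamily.exists_measurableSet_hits (hg : IsKernelFamily g) (u : ℝ)
    {D U : Set (E d)} (hD : IsCompact D) (hU : IsOpen U) :
    ∃ H : Set (Measure (E d × M)), MeasurableSet H ∧
      ∀ μ, IsLocallyFiniteConfig g μ → (μ ∈ H ↔ ((excursionSet g u μ ∩ D) ∩ U).Nonempty) := by
  -- Exhausting `U` by closed sets reduces hitting an open set to hitting countably many compact
  -- sets.
  obtain ⟨F, hF, -, hFU, -⟩ := hU.exists_iUnion_isClosed
  choose H hH hH' using fun n => hg.exists_measurableSet_hits_compact u (hD.inter_right (hF n))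
  refine ⟨⋃ n, H n, MeasurableSet.iUnion hH, fun μ hμ => ?_⟩
  simp only [mem_iUnion, hH' _ μ hμ]
  rw [← hFU, ← nonempty_iUnion]
  simp only [inter_iUnion, inter_assoc]

/-- A measurable functional on the convex ring is a measurable function of the hitting indicators
of a countable base. -/
theorem IsGeometricFunctional.exists_eq_comp_hits {φ : Set (E d) → ℝ}
    (hφ : IsGeometricFunctional φ) : ∃ (U : ℕ → Set (E d)) (ψ : (ℕ → Prop) → ℝ),
      (∀ k, IsOpen (U k)) ∧ Measurable ψ ∧
      ∀ A, IsPolyconvex A → φ A = ψ fun k => (A ∩ U k).Nonempty := by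
  obtain ⟨U, hb⟩ := TopologicalSpace.exists_seq_basis (E d)
  have hUo : ∀ k, IsOpen (U k) := fun k => hb.isOpen (mem_range_self k)
  let hits : ConvexRing d → ℕ → Prop := fun A k => (A.1 ∩ U k).Nonempty
  -- An open set is hit iff some basic set inside it is hit; the Doob-Dynkin factorisation then
  -- gives `ψ`.
  have hle : fellMeasurableSpace d ≤ MeasurableSpace.comap hits MeasurableSpace.pi := by
    refine MeasurableSpace.generateFrom_le ?_
    rintro _ ⟨V, hV, rfl⟩
    refine ⟨⋃ k ∈ {k | U k ⊆ V}, {a | a k}, ?_, ?_⟩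
    · refine MeasurableSet.biUnion (to_countable _) fun k _ => ?_
      exact measurableSet_setOfPred.2 (measurable_pi_apply k)
    · ext A
      simp only [mem_preimage, mem_iUnion, mem_ofPred_eq, exists_prop, hits]
      constructor
      · rintro ⟨k, hk, h⟩
        exact h.mono (inter_subset_inter_right _ hk)
      · rintro ⟨x, hxA, hxV⟩
        obtain ⟨_, ⟨k, rfl⟩, hxB, hBV⟩ := hb.exists_subset_of_mem_open hxV hV
        exact ⟨k, hBV, x, hxA, hxB⟩
  have hm : Measurable[MeasurableSpace.comap hits MeasurableSpace.pi]
      fun A : ConvexRing d => φ A.1 := hφ.measurable.mono hle le_rfl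
  obtain ⟨ψ, hψ, h⟩ := hm.exists_eq_measurable_comp
  exact ⟨U, ψ, hUo, hψ, fun A hA => congrFun h ⟨A, hA⟩⟩

/-- Geometric functionals of the excursion set in a compact window are measurable functions of the
configuration. -/
theorem IsKernelFamily.exists_measurable_eq (hg : IsKernelFamily g) (u : ℝ)
    {φ : Set (E d) → ℝ} (hφ : IsGeometricFunctional φ) {D : Set (E d)} (hD : IsCompact D)
    (hpoly : ∀ μ, IsLocallyFiniteConfig g μ → IsPolyconvex (excursionSet g u μ ∩ D)) :
    ∃ F : Measure (E d × M) → ℝ, Measurable F ∧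
      ∀ μ, IsLocallyFiniteConfig g μ → φ (excursionSet g u μ ∩ D) = F μ := by
  obtain ⟨U, ψ, hU, hψ, h⟩ := hφ.exists_eq_comp_hits
  choose H hH hH' using fun k => hg.exists_measurableSet_hits u hD (hU k)
  refine ⟨fun μ => ψ fun k => μ ∈ H k, hψ.comp (measurable_pi_lambda _ fun k => ?_),
    fun μ hμ => ?_⟩
  · exact measurableSet_setOfPred.1 (hH k)
  · rw [h _ (hpoly μ hμ)]
    simp_rw [hH' _ μ hμ]

theorem IsKernelFamily.exists_measurable_evalHalfOpenCube (hg : IsKernelFamily g) (u : ℝ)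
    {φ : Set (E d) → ℝ} (hφ : IsGeometricFunctional φ) {W : Set (E d)} (hW : IsCompact W)
    (hWc : Convex ℝ W) :
    ∃ F : Measure (E d × M) → ℝ, Measurable F ∧
      ∀ μ, IsLocallyFiniteConfig g μ →
        evalHalfOpenCube φ (excursionSet g u μ ∩ W) = F μ := by
  have hWp := IsPolyconvex.of_convex hW hWc
  have hcube := IsPolyconvex.of_convex (isCompact_unitCube d) (convex_unitCube d)
  have hU := isPolyconvex_upperBoundary d
  obtain ⟨F, hF, hF'⟩ := hg.exists_measurable_eq u hφ (hWp.inter hcube).isCompact fun μ hμ => by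
    rw [← inter_assoc]
    exact (hμ.isPolyconvex_inter hg u hW hWc).inter hcube
  obtain ⟨G, hG, hG'⟩ := hg.exists_measurable_eq u hφ (hWp.inter hU).isCompact fun μ hμ => by
    rw [← inter_assoc]
    exact (hμ.isPolyconvex_inter hg u hW hWc).inter hU
  refine ⟨fun μ => F μ - G μ, hF.sub hG, fun μ hμ => ?_⟩
  rw [evalHalfOpenCube, inter_assoc, inter_assoc, hF' μ hμ, hG' μ hμ]

end Excursion

/-! ### Counting lattice cubes in dilated convex bodies -/

section Counting

variable {d : ℕ}

theorem volume_halfOpenCube_translate (z : Fin d → ℤ) :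
    volume {x : E d | ∀ i, ⌊x i⌋ = z i} = 1 := by
  have e : {x : E d | ∀ i, ⌊x i⌋ = z i} =
      (MeasurableEquiv.toLp 2 (Fin d → ℝ)).symm ⁻¹'
        (Set.univ.pi fun i => Ico (z i : ℝ) (z i + 1)) := by
    ext x
    simp only [mem_ofPred_eq, Int.floor_eq_iff, mem_preimage, mem_univ_pi, mem_Ico]
    rfl
  rw [e, (EuclideanSpace.volume_preserving_symm_measurableEquiv_toLp (Fin d)).measure_preimage_equiv,
    Real.volume_pi_Ico]
  simp

theorem measurableSet_halfOpenCube_translate (z : Fin d → ℤ) :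
    MeasurableSet {x : E d | ∀ i, ⌊x i⌋ = z i} := by
  rw [ofPred_forall]
  refine MeasurableSet.iInter fun i => ?_
  have hm : Measurable fun x : E d => ⌊x i⌋ :=
    Int.measurable_floor.comp (by fun_prop)
  exact hm (measurableSet_singleton (z i))

theorem volume_biUnion_halfOpenCube (S : Finset (Fin d → ℤ)) :
    volume (⋃ z ∈ S, {x : E d | ∀ i, ⌊x i⌋ = z i}) = S.card := by
  rw [measure_biUnion_finset _ fun z _ => measurableSet_halfOpenCube_translate z]
  · simp [volume_halfOpenCube_translate]
  · intro z _ w _ hzw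
    rw [Function.onFun, Set.disjoint_left]
    intro x hz hw
    exact hzw (funext fun i => (hz i).symm.trans (hw i))

theorem norm_sub_lt_of_mem_cube {z : Fin d → ℤ} {x y : E d}
    (hx : x ∈ (fun y => y + latticeVec z) '' unitCube d)
    (hy : y ∈ (fun y => y + latticeVec z) '' unitCube d) : ‖x - y‖ < d + 1 := by
  rw [mem_image_unitCube] at hx hy
  rw [EuclideanSpace.norm_eq, Real.sqrt_lt' (by positivity)]
  calc ∑ i, ‖(x - y) i‖ ^ 2 ≤ ∑ i : Fin d, (1 : ℝ) := by
        refine Finset.sum_le_sum fun i _ => ?_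
        refine pow_le_one₀ (norm_nonneg _) ?_
        rw [Real.norm_eq_abs, PiLp.sub_apply, abs_le]
        constructor <;> linarith [(hx i).1, (hx i).2, (hy i).1, (hy i).2]
    _ < _ := by
        simp
        nlinarith [Nat.cast_nonneg (α := ℝ) d]

theorem mem_cube_floor (x : E d) :
    x ∈ (fun y => y + latticeVec fun i => ⌊x i⌋) '' unitCube d :=
  mem_image_unitCube.2 fun _ => ⟨Int.floor_le _, (Int.lt_floor_add_one _).le⟩

theorem latticeVec_mem_cube (z : Fin d → ℤ) :
    latticeVec z ∈ (fun y => y + latticeVec z) '' unitCube d :=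
  mem_image_unitCube.2 fun i => ⟨le_rfl, by simp⟩

open Classical in
/-- The number of lattice cubes inside and the number of lattice cubes meeting `r • W` both differ
from the volume of `r • W` by the effect of a bounded change of `r`. -/
theorem exists_card_cubes_bounds {W : Set (E d)} (hW : IsCompact W) (hWc : Convex ℝ W)
    (hWpos : 0 < volume W) : ∃ s : ℝ, 0 < s ∧ ∀ r : ℝ, s < r → ∀ T : Finset (Fin d → ℤ),
      (∀ x ∈ r • W, (fun i => ⌊x i⌋) ∈ T) →
      (r - s) ^ d * volume.real W ≤
        (T.filter fun z => (fun y => y + latticeVec z) '' unitCube d ⊆ r • W).card ∧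
      ((T.filter fun z =>
        ((fun y => y + latticeVec z) '' unitCube d ∩ r • W).Nonempty).card : ℝ) ≤
        (r + s) ^ d * volume.real W := by
  obtain ⟨a, ha⟩ : (interior W).Nonempty := by
    by_contra h
    rw [not_nonempty_iff_eq_empty] at h
    have h1 := hWc.addHaar_frontier volume
    rw [frontier, h, sdiff_empty, hW.isClosed.closure_eq] at h1
    exact hWpos.ne' h1
  obtain ⟨ρ, hρ, hball⟩ := Metric.isOpen_iff.1 isOpen_interior a ha
  have hball : Metric.ball a ρ ⊆ W := hball.trans interior_subset
  -- With this choice `s • W` contains the ball of radius `d + 1` about `s • a`, and `d + 1` exceeds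
  -- the diameter of a unit cube.
  set s : ℝ := (d + 1) / ρ with hs
  have hs0 : 0 < s := by positivity
  have hsmall : ∀ v : E d, ‖v‖ < d + 1 → s • a + v ∈ s • W := by
    intro v hv
    refine ⟨a + s⁻¹ • v, hball ?_, ?_⟩
    · rw [Metric.mem_ball, dist_eq_norm, add_sub_cancel_left, norm_smul, norm_inv,
        Real.norm_of_nonneg hs0.le, inv_mul_lt_iff₀ hs0, hs, div_mul_cancel₀ _ hρ.ne']
      exact hv
    · simp only [smul_add, smul_smul, mul_inv_cancel₀ hs0.ne', one_smul]
  have hvol : ∀ (t : ℝ) (b : E d), 0 ≤ t →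
      volume (t • W + {b}) = ENNReal.ofReal (t ^ d * volume.real W) := by
    intro t b ht
    rw [add_singleton, image_add_right, measure_preimage_add_right, Measure.addHaar_smul,
      finrank_euclideanSpace_fin, abs_of_nonneg (by positivity), ENNReal.ofReal_mul (by positivity),
      ofReal_measureReal hW.measure_lt_top.ne]
  refine ⟨s, hs0, fun r hr T hT => ⟨?_, ?_⟩⟩
  -- Every point of the shifted body has its whole cube in `(r - s) • W + s • W`, which equals `r •
  -- W` by convexity.
  · have hsub : (r - s) • W + {s • a} ⊆
        ⋃ z ∈ T.filter fun z => (fun y => y + latticeVec z) '' unitCube d ⊆ r • W,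
          {x : E d | ∀ i, ⌊x i⌋ = z i} := by
      rintro _ ⟨w, hw, _, rfl, rfl⟩
      set y : E d := w + s • a
      have hcube : (fun x => x + latticeVec fun i => ⌊y i⌋) '' unitCube d ⊆ r • W := by
        intro x hx
        have hxy := norm_sub_lt_of_mem_cube hx (mem_cube_floor y)
        have h1 : x ∈ (r - s) • W + s • W :=
          ⟨w, hw, s • a + (x - y), hsmall _ hxy, by simp only [y]; abel⟩
        rwa [← hWc.add_smul (sub_nonneg.2 hr.le) hs0.le, sub_add_cancel] at h1
      simp only [mem_iUnion, Finset.mem_filter, exists_prop]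
      refine ⟨_, ⟨?_, hcube⟩, fun i => rfl⟩
      exact hT y (hcube (mem_cube_floor y))
    have := measure_mono (μ := volume) hsub
    rw [volume_biUnion_halfOpenCube, hvol _ _ (sub_nonneg.2 hr.le), ← ENNReal.ofReal_natCast,
      ENNReal.ofReal_le_ofReal_iff (by positivity)] at this
    exact this
  · have hsub : (⋃ z ∈ T.filter fun z =>
          ((fun y => y + latticeVec z) '' unitCube d ∩ r • W).Nonempty,
          {x : E d | ∀ i, ⌊x i⌋ = z i}) ⊆ (r + s) • W + {- (s • a)} := by
      intro x hx
      simp only [mem_iUnion, Finset.mem_filter, exists_prop] at hx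
      obtain ⟨z, ⟨-, y, hyz, hyW⟩, hxz⟩ := hx
      have hxz' : x ∈ (fun y => y + latticeVec z) '' unitCube d := by
        have := mem_cube_floor x
        rwa [show (fun i => ⌊x i⌋) = z from funext hxz] at this
      have hxy := norm_sub_lt_of_mem_cube hxz' hyz
      rw [hWc.add_smul (hs0.trans hr).le hs0.le]
      exact ⟨y + (s • a + (x - y)), ⟨y, hyW, _, hsmall _ hxy, rfl⟩, _, rfl, by abel_nf⟩
    have := measure_mono (μ := volume) hsub
    rw [volume_biUnion_halfOpenCube, hvol _ _ (by linarith), ← ENNReal.ofReal_natCast,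
      ENNReal.ofReal_le_ofReal_iff (by have : 0 < r + s := by linarith
                                       positivity)] at this
    exact this

theorem exists_finset_floor_mem {A : Set (E d)} (hA : IsCompact A) :
    ∃ T : Finset (Fin d → ℤ), ∀ x ∈ A, (fun i => ⌊x i⌋) ∈ T := by
  obtain ⟨R, hR⟩ := hA.isBounded.subset_closedBall 0
  refine ⟨Finset.Icc (fun _ => ⌊-R⌋) (fun _ => ⌊R⌋), fun x hx => ?_⟩
  have hx' := mem_closedBall_zero_iff.1 (hR hx)
  rw [Finset.mem_Icc]
  constructor <;> intro i <;> have h := (PiLp.norm_apply_le x i).trans hx' <;>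
    rw [Real.norm_eq_abs, abs_le] at h
  · exact Int.floor_mono h.1
  · exact Int.floor_mono h.2

end Counting

/-! ### Stationarity and the density of geometric functionals -/

section Stationarity

variable {d : ℕ} {M : Type*} [MeasurableSpace M] {g : M → E d → ℝ}

/-- The translation of marked points by `-x`. -/
def shift (x : E d) (p : E d × M) : E d × M := (p.1 - x, p.2)

theorem measurePreserving_shift (γ : ℝ≥0) (Q : Measure M) [IsProbabilityMeasure Q] (x : E d) :
    MeasurePreserving (shift x) (γ • (volume : Measure (E d)).prod Q)
      (γ • (volume : Measure (E d)).prod Q) :=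
  ((measurePreserving_sub_right volume x).prod (MeasurePreserving.id Q)).smul_measure γ

theorem IsKernelFamily.excursionSet_map_shift (hg : IsKernelFamily g) (u : ℝ)
    (μ : Measure (E d × M)) (x : E d) :
    excursionSet g u (μ.map (shift x)) = (fun y => y + x) ⁻¹' excursionSet g u μ := by
  ext y
  have hm : Measurable (shift x : E d × M → E d × M) :=
    (measurable_fst.sub_const x).prodMk measurable_snd
  simp only [excursionSet, mem_ofPred_eq, mem_preimage, shotNoise]
  rw [lintegral_map (hg.measurable_ofReal_sub y) hm]
  simp only [shift, sub_sub_eq_add_sub]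

variable {Ω : Type*} [MeasurableSpace Ω] {P : Measure Ω} {Λ : Measure (E d × M)}
  {η η' : Ω → Measure (E d × M)} {φ : Set (E d) → ℝ}

theorem IsPoissonProcess.ae_isLocallyFiniteConfig (hη : IsPoissonProcess P Λ η)
    (hg : IsKernelFamily g) (hfin : ∀ n : ℕ, Λ (hitting g n) < ∞) :
    ∀ᵐ ω ∂P, IsLocallyFiniteConfig g (η ω) := by
  have h : ∀ᵐ ω ∂P, ∀ n : ℕ, η ω (hitting g n) < ∞ := ae_all_iff.2 fun n =>
    hη.ae_lt_top (hg.measurableSet_hitting (Nat.cast_nonneg n)) (hfin n).ne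
  filter_upwards [hη.counting, h] with ω h1 h2
  exact ⟨h1, h2⟩

/-- The contributions of half-open cubes are integrable, with a bound depending only on the
intensity measure. -/
theorem exists_bound_evalHalfOpenCube [IsProbabilityMeasure P] (hg : IsKernelFamily g)
    (hfin : ∀ n : ℕ, Λ (hitting g n) < ∞) (u : ℝ) (hφ : IsGeometricFunctional φ) :
    ∃ c : ℝ, ∀ η : Ω → Measure (E d × M), IsPoissonProcess P Λ η →
      ∀ W : Set (E d), IsCompact W → Convex ℝ W →
        Integrable (fun ω => evalHalfOpenCube φ (excursionSet g u (η ω) ∩ W)) P ∧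
        |∫ ω, evalHalfOpenCube φ (excursionSet g u (η ω) ∩ W) ∂P| ≤ c := by
  obtain ⟨C, hC⟩ := hφ.locally_bounded
  have hC0 : 0 ≤ C := by
    simpa [hφ.empty] using hC ∅ isCompact_empty convex_empty (empty_subset _)
  have hm : MeasurableSet (hitting g (d + 1 : ℕ)) := hg.measurableSet_hitting (Nat.cast_nonneg _)
  have hΛ := (hfin (d + 1)).ne
  have hpow : Measurable fun a : ℝ≥0∞ => (3 : ℝ) ^ a.toReal :=
    measurable_const.pow ENNReal.measurable_toReal
  -- The constant is written through the Poisson law rather than through `η`, so that one value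
  -- serves all shifted processes and all windows.
  refine ⟨(1 + 3 ^ d) * ((∫ a : ℝ≥0∞, (3 : ℝ) ^ a.toReal
    ∂((poissonMeasure (Λ (hitting g (d + 1 : ℕ))).toNNReal).map fun n : ℕ => (n : ℝ≥0∞))) * C),
    fun η hη W hW hWc => ?_⟩
  have hbound : ∀ᵐ ω ∂P, ‖evalHalfOpenCube φ (excursionSet g u (η ω) ∩ W)‖ ≤
      (1 + 3 ^ d) * ((3 : ℝ) ^ (η ω (hitting g (d + 1 : ℕ))).toReal * C) := by
    filter_upwards [hη.ae_isLocallyFiniteConfig hg hfin] with ω hω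
    exact hφ.abs_evalHalfOpenCube_le (by positivity)
      (fun D hD hDc => hω.isPolyconvex_inter hg u hD hDc)
      (fun D hD hDc hDC => hω.abs_le hg u hφ hC hD hDc hDC) hW hWc
  have hint := ((hη.integrable_rpow hm hΛ).mul_const C).const_mul (1 + 3 ^ d)
  obtain ⟨F, hF, hF'⟩ := hg.exists_measurable_evalHalfOpenCube u hφ hW hWc
  refine ⟨hint.mono' ?_ hbound, ?_⟩
  · refine (hF.comp hη.measurable).aestronglyMeasurable.congr ?_
    filter_upwards [hη.ae_isLocallyFiniteConfig hg hfin] with ω hω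
    exact (hF' _ hω).symm
  · refine (norm_integral_le_of_norm_le hint hbound).trans_eq ?_
    rw [integral_const_mul, integral_mul_const, ← hη.poisson _ hm hΛ,
      integral_map (hη.measurable_apply hm).aemeasurable hpow.aestronglyMeasurable]

theorem evalHalfOpenCube_inter_of_subset (φ : Set (E d) → ℝ) (A : Set (E d)) {W : Set (E d)}
    (hW : unitCube d ⊆ W) : evalHalfOpenCube φ (A ∩ W) = evalHalfOpenCube φ A := by
  have hU : upperBoundary d ⊆ W := sdiff_subset.trans hW
  rw [evalHalfOpenCube, evalHalfOpenCube, inter_assoc, inter_assoc, inter_eq_right.2 hW,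
    inter_eq_right.2 hU]

theorem evalHalfOpenCube_eq_zero (φ : Set (E d) → ℝ) {A : Set (E d)}
    (hA : A ∩ unitCube d = ∅) : evalHalfOpenCube φ A = 0 := by
  have hU : A ∩ upperBoundary d = ∅ :=
    subset_empty_iff.1 ((inter_subset_inter_right A sdiff_subset).trans hA.subset)
  rw [evalHalfOpenCube, hA, hU, sub_self]

/-- Both integrands agree almost surely with the same measurable function of the process, and the
intensity determines the law. -/
theorem integral_evalHalfOpenCube_eq [IsProbabilityMeasure P] (hη : IsPoissonProcess P Λ η)
    (hη' : IsPoissonProcess P Λ η') (hg : IsKernelFamily g)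
    (hfin : ∀ n : ℕ, Λ (hitting g n) < ∞) (u : ℝ) (hφ : IsGeometricFunctional φ) :
    ∫ ω, evalHalfOpenCube φ (excursionSet g u (η ω)) ∂P =
      ∫ ω, evalHalfOpenCube φ (excursionSet g u (η' ω)) ∂P := by
  obtain ⟨F, hF, hF'⟩ := hg.exists_measurable_evalHalfOpenCube u hφ (isCompact_unitCube d)
    (convex_unitCube d)
  have key : ∀ ζ : Ω → Measure (E d × M), IsPoissonProcess P Λ ζ →
      ∫ ω, evalHalfOpenCube φ (excursionSet g u (ζ ω)) ∂P = ∫ μ, F μ ∂(P.map ζ) := by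
    intro ζ hζ
    rw [integral_map hζ.measurable.aemeasurable hF.aestronglyMeasurable]
    refine integral_congr_ae ?_
    filter_upwards [hζ.ae_isLocallyFiniteConfig hg hfin] with ω hω
    rw [← hF' _ hω, evalHalfOpenCube_inter_of_subset φ _ subset_rfl]
  rw [key η hη, key η' hη', hη.map_eq hη']

theorem isCompact_preimage_add {W : Set (E d)} (hW : IsCompact W) (x : E d) :
    IsCompact ((fun y => y + x) ⁻¹' W) :=
  (Homeomorph.addRight x).isCompact_preimage.2 hW

/-- The decomposition of a geometric functional of the excursion set in a convex window into the
contributions of shifted processes in the half-open unit cube. -/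
theorem IsKernelFamily.eq_sum_shift (hg : IsKernelFamily g) (u : ℝ)
    (hφ : IsGeometricFunctional φ) {μ : Measure (E d × M)} (hμ : IsLocallyFiniteConfig g μ)
    {W : Set (E d)} (hW : IsCompact W) (hWc : Convex ℝ W) {T : Finset (Fin d → ℤ)}
    (hT : ∀ x ∈ W, (fun i => ⌊x i⌋) ∈ T) :
    φ (excursionSet g u μ ∩ W) = ∑ z ∈ T, evalHalfOpenCube φ
      (excursionSet g u (μ.map (shift (latticeVec z))) ∩ (fun y => y + latticeVec z) ⁻¹' W) := by
  rw [hφ.eq_sum_evalHalfOpenCube (hμ.isPolyconvex_inter hg u hW hWc) fun x hx => hT x hx.2]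
  simp_rw [hg.excursionSet_map_shift, preimage_inter]

open Classical in
/-- The mean of a geometric functional in a convex window differs from its cube density times the
number of cubes in the window at most by a multiple of the number of boundary cubes. -/
theorem abs_integral_sub_card_mul_le [IsProbabilityMeasure P] (hη : IsPoissonProcess P Λ η)
    (hshift : ∀ x : E d, MeasurePreserving (shift x) Λ Λ) (hg : IsKernelFamily g)
    (hfin : ∀ n : ℕ, Λ (hitting g n) < ∞) (u : ℝ) (hφ : IsGeometricFunctional φ) :
    ∃ c : ℝ, ∀ W : Set (E d), IsCompact W → Convex ℝ W →
      Integrable (fun ω => φ (excursionSet g u (η ω) ∩ W)) P ∧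
      ∀ T : Finset (Fin d → ℤ), (∀ x ∈ W, (fun i => ⌊x i⌋) ∈ T) →
        |∫ ω, φ (excursionSet g u (η ω) ∩ W) ∂P -
          (T.filter fun z => (fun y => y + latticeVec z) '' unitCube d ⊆ W).card *
            ∫ ω, evalHalfOpenCube φ (excursionSet g u (η ω)) ∂P| ≤
        c * ((T.filter fun z =>
            ((fun y => y + latticeVec z) '' unitCube d ∩ W).Nonempty).card -
          (T.filter fun z => (fun y => y + latticeVec z) '' unitCube d ⊆ W).card) := by
  obtain ⟨c, hc⟩ := exists_bound_evalHalfOpenCube (P := P) hg hfin u hφ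
  set e := ∫ ω, evalHalfOpenCube φ (excursionSet g u (η ω)) ∂P with he
  have hζ : ∀ x, IsPoissonProcess P Λ fun ω => (η ω).map (shift x) := fun x =>
    hη.map_measurePreserving (hshift x)
  refine ⟨c, fun W hW hWc => ?_⟩
  let f : (Fin d → ℤ) → Ω → ℝ := fun z ω => evalHalfOpenCube φ
    (excursionSet g u ((η ω).map (shift (latticeVec z))) ∩ (fun y => y + latticeVec z) ⁻¹' W)
  have hf := fun z : Fin d → ℤ => hc _ (hζ (latticeVec z)) _
    (isCompact_preimage_add hW (latticeVec z)) (hWc.translate_preimage_left (latticeVec z))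
  have hsum : ∀ T : Finset (Fin d → ℤ), (∀ x ∈ W, (fun i => ⌊x i⌋) ∈ T) →
      (fun ω => φ (excursionSet g u (η ω) ∩ W)) =ᵐ[P] fun ω => ∑ z ∈ T, f z ω := by
    intro T hT
    filter_upwards [hη.ae_isLocallyFiniteConfig hg hfin] with ω hω
    exact hg.eq_sum_shift u hφ hω hW hWc hT
  refine ⟨?_, fun T hT => ?_⟩
  · obtain ⟨T, hT⟩ := exists_finset_floor_mem hW
    exact (integrable_finsetSum T fun z _ => (hf z).1).congr (hsum T hT).symm
  · rw [integral_congr_ae (hsum T hT), integral_finsetSum T fun z _ => (hf z).1]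
    set I := T.filter fun z => (fun y => y + latticeVec z) '' unitCube d ⊆ W with hI
    set J := T.filter fun z => ((fun y => y + latticeVec z) '' unitCube d ∩ W).Nonempty with hJ
    have hin : ∀ z ∈ I, ∫ ω, f z ω ∂P = e := by
      intro z hz
      have hz' : unitCube d ⊆ (fun y => y + latticeVec z) ⁻¹' W :=
        image_subset_iff.1 (Finset.mem_filter.1 hz).2
      simp only [f, evalHalfOpenCube_inter_of_subset φ _ hz']
      exact integral_evalHalfOpenCube_eq (hζ _) hη hg hfin u hφ
    have hout : ∀ z ∈ T, z ∉ J → ∫ ω, f z ω ∂P = 0 := by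
      intro z hz hzJ
      have hz' : (fun y => y + latticeVec z) ⁻¹' W ∩ unitCube d = ∅ := by
        by_contra hne
        obtain ⟨x, hxW, hx⟩ := nonempty_iff_ne_empty.2 hne
        exact hzJ (Finset.mem_filter.2 ⟨hz, x + latticeVec z, mem_image_of_mem _ hx, hxW⟩)
      have : ∀ ω, f z ω = 0 := fun ω => evalHalfOpenCube_eq_zero φ (by
        rw [inter_assoc, hz', inter_empty])
      simp [this]
    have hIJ : I ⊆ J := by
      intro z hz
      rw [hI, Finset.mem_filter] at hz
      exact Finset.mem_filter.2
        ⟨hz.1, latticeVec z, latticeVec_mem_cube z, hz.2 (latticeVec_mem_cube z)⟩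
    -- Cubes missing `W` contribute zero and those inside `W` cancel, which leaves the boundary
    -- cubes `J \ I`, each with mean at most `c` in absolute value.
    rw [← Finset.sum_subset (Finset.filter_subset _ T) hout, ← Finset.sum_sdiff hIJ,
      Finset.sum_congr rfl hin, Finset.sum_const, nsmul_eq_mul, add_sub_cancel_right,
      ← Nat.cast_sub (Finset.card_le_card hIJ), ← Finset.card_sdiff_of_subset hIJ, mul_comm,
      ← nsmul_eq_mul, ← Finset.sum_const]
    exact (Finset.abs_sum_le_sum_abs _ _).trans (Finset.sum_le_sum fun z _ => (hf z).2)

end Stationarity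

/-! ### Passage to the limit. -/

theorem volume_real_smul {d : ℕ} (W : Set (E d)) {r : ℝ} (hr : 0 ≤ r) :
    volume.real (r • W) = r ^ d * volume.real W := by
  rw [Measure.real, Measure.addHaar_smul, finrank_euclideanSpace_fin, abs_of_nonneg (by positivity),
    ENNReal.toReal_mul, ENNReal.toReal_ofReal (by positivity), Measure.real]

/-- A function of the dilation factor which is given by cube counting up to boundary cubes has the
cube density as its limit per unit volume. -/
theorem tendsto_div_volume_of_abs_sub_card_mul_le {d : ℕ} {W : Set (E d)} (hW : IsCompact W)
    (hWpos : 0 < volume W) {f : ℝ → ℝ} {e c s : ℝ} (hs : 0 < s)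
    (hc : 0 ≤ c) {I J : ℝ → ℝ} (hI : ∀ r, s < r → (r - s) ^ d * volume.real W ≤ I r)
    (hJ : ∀ r, s < r → J r ≤ (r + s) ^ d * volume.real W)
    (hIJ : ∀ r, s < r → I r ≤ J r)
    (hf : ∀ r, s < r → |f r - I r * e| ≤ c * (J r - I r)) :
    Tendsto (fun r => f r / volume.real (r • W)) atTop (𝓝 e) := by
  have hV : 0 < volume.real W := ENNReal.toReal_pos hWpos.ne' hW.measure_lt_top.ne
  have hinv : Tendsto (fun r : ℝ => s * r⁻¹) atTop (𝓝 0) := by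
    simpa using tendsto_inv_atTop_zero.const_mul s
  -- Both `J r - I r` and the distance from `I r` to the volume of `r • W` are at most `(r + s) ^ d
  -- - (r - s) ^ d` times the volume of `W`; they enter with the factors `c` and `|e|`.
  have hlim : Tendsto (fun r : ℝ => (c + |e|) * ((1 + s * r⁻¹) ^ d - (1 - s * r⁻¹) ^ d)) atTop
      (𝓝 0) := by
    simpa using (((hinv.const_add 1).pow d).sub ((hinv.const_sub 1).pow d)).const_mul (c + |e|)
  rw [tendsto_iff_norm_sub_tendsto_zero]
  refine squeeze_zero' (Eventually.of_forall fun r => norm_nonneg _) ?_ hlim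
  filter_upwards [eventually_gt_atTop s] with r hr
  have hr0 : 0 < r := hs.trans hr
  have hrd : 0 < r ^ d * volume.real W := by positivity
  rw [volume_real_smul W hr0.le]
  have e1 : (1 + s * r⁻¹) ^ d - (1 - s * r⁻¹) ^ d =
      ((r + s) ^ d * volume.real W - (r - s) ^ d * volume.real W) / (r ^ d * volume.real W) := by
    rw [show 1 + s * r⁻¹ = (r + s) / r by field_simp, show 1 - s * r⁻¹ = (r - s) / r by field_simp,
      div_pow, div_pow]
    field_simp
  have e2 : f r / (r ^ d * volume.real W) - e =
      (f r - I r * e + (I r - r ^ d * volume.real W) * e) / (r ^ d * volume.real W) := by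
    field_simp
    ring
  rw [e1, e2, norm_div, Real.norm_of_nonneg hrd.le, ← mul_div_assoc]
  refine div_le_div_of_nonneg_right ?_ hrd.le
  have h1 := hI r hr
  have h2 := hJ r hr
  have h3 := hIJ r hr
  have h4 : (r - s) ^ d * volume.real W ≤ r ^ d * volume.real W := by
    have := sub_nonneg.2 hr.le
    gcongr
    linarith
  have h5 : r ^ d * volume.real W ≤ (r + s) ^ d * volume.real W := by
    gcongr
    linarith
  calc _ ≤ |f r - I r * e| + |(I r - r ^ d * volume.real W) * e| := abs_add_le _ _
    _ ≤ c * (J r - I r) + ((r + s) ^ d * volume.real W - (r - s) ^ d * volume.real W) * |e| := by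
        rw [abs_mul]
        gcongr
        · exact hf r hr
        · rw [abs_le]; constructor <;> linarith
    _ ≤ _ := by
        have : c * (J r - I r) ≤
            c * ((r + s) ^ d * volume.real W - (r - s) ^ d * volume.real W) := by
          gcongr
        linarith

end ShotNoise

theorem mainTheorem4 {d : ℕ} (hd : 1 ≤ d)
    {M : Type*} [MeasurableSpace M] (Q : Measure M) [IsProbabilityMeasure Q]
    {Ω : Type*} [MeasurableSpace Ω] (P : Measure Ω) [IsProbabilityMeasure P]
    (γ : ℝ≥0) (hγ : 0 < γ)
    (η : Ω → Measure (ShotNoise.E d × M))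
    (hη : ShotNoise.IsPoissonProcess P
      (γ • (volume : Measure (ShotNoise.E d)).prod Q) η)
    (g : M → ShotNoise.E d → ℝ) (hg : ShotNoise.IsKernelFamily g)
    (hmoment : ∀ i : Fin (d + 1), 1 ≤ (i : ℕ) →
      Integrable (fun m => ShotNoise.intrinsicVolume i (tsupport (g m))) Q)
    (W : Set (ShotNoise.E d)) (hWcompact : IsCompact W) (hWconvex : Convex ℝ W)
    (hWpos : 0 < volume W)
    (u : ℝ) (hu : 0 < u)
    (φ : Set (ShotNoise.E d) → ℝ) (hφ : ShotNoise.IsGeometricFunctional φ) :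
    (∀ r : ℝ, 1 ≤ r →
      (∀ᵐ ω ∂P, ShotNoise.IsPolyconvex (ShotNoise.excursionSet g u (η ω) ∩ r • W)) ∧
      Integrable (fun ω => φ (ShotNoise.excursionSet g u (η ω) ∩ r • W)) P) ∧
    (∀ᵐ ω ∂P,
      ShotNoise.IsPolyconvex (ShotNoise.excursionSet g u (η ω) ∩ ShotNoise.unitCube d) ∧
      ShotNoise.IsPolyconvex (ShotNoise.excursionSet g u (η ω) ∩ ShotNoise.upperBoundary d)) ∧
    Integrable (fun ω => ShotNoise.evalHalfOpenCube φ (ShotNoise.excursionSet g u (η ω))) P ∧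
    Tendsto
      (fun r : ℝ =>
        (∫ ω, φ (ShotNoise.excursionSet g u (η ω) ∩ r • W) ∂P) / volume.real (r • W))
      atTop
      (𝓝 (∫ ω, ShotNoise.evalHalfOpenCube φ (ShotNoise.excursionSet g u (η ω)) ∂P)) := by
  classical
  have hfin : ∀ n : ℕ, (γ • (volume : Measure (ShotNoise.E d)).prod Q) (ShotNoise.hitting g n) < ∞ :=
    fun n => hg.measure_hitting_lt_top γ hmoment (Nat.cast_nonneg n)
  have hgood := hη.ae_isLocallyFiniteConfig hg hfin
  obtain ⟨c, hc⟩ := ShotNoise.abs_integral_sub_card_mul_le hη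
    (ShotNoise.measurePreserving_shift γ Q) hg hfin u hφ
  have hrW : ∀ r : ℝ, IsCompact (r • W) ∧ Convex ℝ (r • W) := fun r =>
    ⟨hWcompact.smul r, hWconvex.smul r⟩
  refine ⟨fun r _ => ⟨?_, (hc _ (hrW r).1 (hrW r).2).1⟩, ?_, ?_, ?_⟩
  · filter_upwards [hgood] with ω hω
    exact hω.isPolyconvex_inter hg u (hrW r).1 (hrW r).2
  · filter_upwards [hgood] with ω hω
    exact ⟨hω.isPolyconvex_inter hg u (ShotNoise.isCompact_unitCube d)
      (ShotNoise.convex_unitCube d), ShotNoise.isPolyconvex_inter_upperBoundary fun D hD hDc =>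
        hω.isPolyconvex_inter hg u hD hDc⟩
  · obtain ⟨c', hc'⟩ := ShotNoise.exists_bound_evalHalfOpenCube (P := P) hg hfin u hφ
    have := (hc' η hη _ (ShotNoise.isCompact_unitCube d) (ShotNoise.convex_unitCube d)).1
    simpa only [ShotNoise.evalHalfOpenCube_inter_of_subset φ _ subset_rfl] using this
  · obtain ⟨s, hs, hcard⟩ := ShotNoise.exists_card_cubes_bounds hWcompact hWconvex hWpos
    choose T hT using fun r => ShotNoise.exists_finset_floor_mem (hrW r).1
    have hIJ : ∀ r, (((T r).filter fun z =>
        (fun y => y + ShotNoise.latticeVec z) '' ShotNoise.unitCube d ⊆ r • W).card : ℝ) ≤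
        ((T r).filter fun z =>
          ((fun y => y + ShotNoise.latticeVec z) '' ShotNoise.unitCube d ∩ r • W).Nonempty).card := by
      intro r
      refine Nat.cast_le.2 (Finset.card_le_card ?_)
      refine Finset.monotone_filter_right _ fun z _ hz => ?_
      exact ⟨_, ShotNoise.latticeVec_mem_cube z, hz (ShotNoise.latticeVec_mem_cube z)⟩
    -- The constant `c` comes without a sign, so it is replaced by `|c|`, which is harmless because
    -- the count of boundary cubes is nonnegative.
    refine ShotNoise.tendsto_div_volume_of_abs_sub_card_mul_le hWcompact hWpos hs
      (abs_nonneg c) (fun r hr => (hcard r hr (T r) (hT r)).1)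
      (fun r hr => (hcard r hr (T r) (hT r)).2) (fun r _ => hIJ r) fun r _ => ?_
    refine ((hc _ (hrW r).1 (hrW r).2).2 (T r) (hT r)).trans ?_
    exact mul_le_mul_of_nonneg_right (le_abs_self c) (sub_nonneg.2 (hIJ r))
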